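/- **Setting.** Regard $\mathbb S^3$ as the unit quaternions in $\mathbb H$, with the tangent vectors at $(p,q)\in\mathbb S^3\times\mathbb S^3$ written as $Z=(U,V)$. Let $\langle\cdot,\cdot\rangle$ be the Euclidean product metric, $$J(U,V)=\tfrac1{\sqrt3}\,(2pq^{-1}V-U,\,-2qp^{-1}U+V),\qquad P(U,V)=(pq^{-1}V,\,qp^{-1}U),$$ and let $g(Z,Z')=\frac12(\langle Z,Z'\rangle+\langle JZ,JZ'\rangle)$ be the nearly Kähler metric. Let $\gamma=(x,y):\mathbb R\to\mathbb S^3\times\mathbb S^3$ be a nonconstant geodesic of $g$, that is, a smooth regular curve with $\nabla_{\gamma'}\gamma'=0$ for the Levi-Civita connection of $g$. Write $\gamma'=(x\alpha,y\beta)$ with $\alpha,\beta:\mathbb R\to\operatorname{Im}\mathbb H$, and put $c_1=\alpha(0)+\beta(0)$ (in fact $\alpha+\beta\equiv c_1$). If $c_1\ne0$, put $$d_1=\frac{\langle\alpha(0)-\beta(0),c_1\rangle}{\|c_1\|^2}\in\mathbb R,\qquad c_2=\alpha(0)-\beta(0)-d_1c_1.$$ For $n_1,n_2>0$ and $d\in\mathbb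 R$ set $a=\frac{1+d}2n_1$, $\tilde a=\frac{1-d}2n_1$, $b=\frac12n_2$, $\tilde b=-\frac12n_2$, $c=\frac23n_1$, $$A,B=\tfrac12\Bigl(c\pm\sqrt{(2a-c)^2+4b^2}\Bigr),\qquad \varphi=\frac{c-2a+\sqrt{(c-2a)^2+4b^2}}{2b},$$ with $A$ taking the sign $+$ and $B$ the sign $-$, and define $\tilde A,\tilde B,\tilde\varphi$ by the same formulas with $\tilde a,\tilde b$ in place of $a,b$. Put $$f_{A,B,\varphi}(t)=\tfrac{\cos At+\varphi^2\cos Bt}{1+\varphi^2}+\tfrac{\sin At+\varphi^2\sin Bt}{1+\varphi^2}\,i+\tfrac{\varphi(\sin At-\sin Bt)}{1+\varphi^2}\,j+\tfrac{\varphi(\cos At-\cos Bt)}{1+\varphi^2}\,k .$$ Consider the curves * case (1): $(\cos a_0t+\sin a_0t\,i,\ \cos a_0t-\sin a_0t\,i)$ with $a_0\in\mathbb R\setminus\{0\}$; * case (2): $(\cos at+\sin at\,i,\ \cos\tilde at+\sin\tilde at\,i)$ with $n_1>0$, $d\in\mathbb R$; * case (3): $(f_{A,B,\varphi}(t),\,f_{\tilde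 A,\tilde B,\tilde\varphi}(t))$ with $n_1,n_2>0$, $d\in\mathbb R$. Say that $\gamma$ *has the parametrization* $\delta=(\delta_1,\delta_2)$ if $\gamma=(u\,\delta_1h^{-1},\,v\,\delta_2h^{-1})$ for some unit quaternions $u,v,h$. **Proposition 3.1.** 1. $\gamma$ is also a geodesic of the Euclidean product metric if and only if $c_1=0$ or $c_2=0$. (When $c_1=0$ the first alternative holds, so $c_2$ is not needed.) 2. $P\gamma'=-\gamma'$ (at all times) if and only if $c_1=0$; and $P\gamma'=\gamma'$ (at all times) if and only if $c_1\neq0$, $c_2=0$ and $d_1=0$. 3. $\gamma$ is closed (that is, periodic) if and only if it has a parametrization of case (1), or one of case (2) with $a/\tilde a\in\mathbb Q$, or one of case (3) with $B/A\in\mathbb Q$ and $\tilde B/\tilde A\in\mathbb Q$. Here the condition $a/\tilde a\in\mathbb Q$ counts as satisfied when $\tilde a=0$; $A$ and $\tilde A$ are always positive. In terms of the constants of $\gamma$: $\gamma$ is closed if and only if $c_1=0$; or $c_1\ne0$, $c_2=0$ and $a/\tilde a\in\mathbb Q$; or $c_1\neq0$, $c_2\ne0$ and $B/A,\tilde B/\tilde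 A\in\mathbb Q$, where $n_1=\|c_1\|$, $n_2=\|c_2\|$, $d=d_1$. -/

import Mathlib

open scoped ContDiff Quaternion

noncomputable section

namespace NKS3S3

/-! ## The manifold `S³ × S³` in `ℍ × ℍ`, its tensors and its two metrics -/

/-- The quaternions. -/
abbrev Quat : Type := Quaternion ℝ

/-- The ambient space `ℍ × ℍ = ℝ⁸`. -/
abbrev Amb : Type := Quat × Quat

/-- `S³ × S³`, as the set of pairs of unit quaternions. -/
def S3S3 : Set Amb := {x | ‖x.1‖ = 1 ∧ ‖x.2‖ = 1}

/-- The tangent space `T_p S³ ⊕ T_q S³` at `(p, q)`: pairs `(U, V)` with `U ⟂ p`, `V ⟂ q`. -/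
def tangentAt (x : Amb) : Set Amb := {Z | inner ℝ Z.1 x.1 = 0 ∧ inner ℝ Z.2 x.2 = 0}

/-- The almost complex structure
`J (U, V) = (1 / √3) (2 p q⁻¹ V - U, -2 q p⁻¹ U + V)` at `x = (p, q)`. -/
def J (x Z : Amb) : Amb :=
  (1 / √3 : ℝ) • (2 * (x.1 * x.2⁻¹ * Z.2) - Z.1, -(2 * (x.2 * x.1⁻¹ * Z.1)) + Z.2)

/-- The almost product structure `P (U, V) = (p q⁻¹ V, q p⁻¹ U)` at `x = (p, q)`. -/
def P (x Z : Amb) : Amb := (x.1 * x.2⁻¹ * Z.2, x.2 * x.1⁻¹ * Z.1)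

/-- The usual Euclidean product metric. -/
def gE (_x Z Z' : Amb) : ℝ := inner ℝ Z.1 Z'.1 + inner ℝ Z.2 Z'.2

/-- The nearly Kähler metric `g(Z, Z') = (⟨Z, Z'⟩ + ⟨JZ, JZ'⟩) / 2`. -/
def gNK (x Z Z' : Amb) : ℝ := (1 / 2) * (gE x Z Z' + gE x (J x Z) (J x Z'))

/-! ## Vector fields, Levi-Civita connection, geodesics

A smooth vector field (or function) on the closed submanifold `S³ × S³` is represented by a smooth
extension to `ℍ × ℍ`; two representatives are the same field when they agree on `S³ × S³`, and all
conditions below are imposed at points of `S³ × S³` only, where derivatives in tangent directions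
and Lie brackets of tangent fields do not depend on the extensions. -/

/-- Smooth tangent vector fields on `S³ × S³`. -/
def IsVF (X : Amb → Amb) : Prop := ContDiff ℝ ∞ X ∧ ∀ x ∈ S3S3, X x ∈ tangentAt x

/-- `D X Y = ∇_X Y` is the Levi-Civita connection of the metric `g` on `S³ × S³`: an affine
connection on smooth vector fields that is torsion free and compatible with `g`.
(By the fundamental theorem of Riemannian geometry there is exactly one, up to the choice of
extensions off `S³ × S³`.) -/
structure IsLeviCivita (g : Amb → Amb → Amb → ℝ) (D : (Amb → Amb) → (Amb → Amb) → Amb → Amb) :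
    Prop where
  isVF : ∀ X Y, IsVF X → IsVF Y → IsVF (D X Y)
  add_left : ∀ X X' Y, IsVF X → IsVF X' → IsVF Y → ∀ x ∈ S3S3,
    D (fun y => X y + X' y) Y x = D X Y x + D X' Y x
  smul_left : ∀ (f : Amb → ℝ) (X Y : Amb → Amb), ContDiff ℝ ∞ f → IsVF X → IsVF Y → ∀ x ∈ S3S3,
    D (fun y => f y • X y) Y x = f x • D X Y x
  add_right : ∀ X Y Y', IsVF X → IsVF Y → IsVF Y' → ∀ x ∈ S3S3,
    D X (fun y => Y y + Y' y) x = D X Y x + D X Y' x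
  leibniz : ∀ (f : Amb → ℝ) (X Y : Amb → Amb), ContDiff ℝ ∞ f → IsVF X → IsVF Y → ∀ x ∈ S3S3,
    D X (fun y => f y • Y y) x = f x • D X Y x + (fderiv ℝ f x (X x)) • Y x
  torsion_free : ∀ X Y, IsVF X → IsVF Y → ∀ x ∈ S3S3,
    D X Y x - D Y X x = VectorField.lieBracket ℝ X Y x
  metric : ∀ X Y Z, IsVF X → IsVF Y → IsVF Z → ∀ x ∈ S3S3,
    fderiv ℝ (fun y => g y (Y y) (Z y)) x (X x) = g x (D X Y x) (Z x) + g x (Y x) (D X Z x)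

/-- `γ : ℝ → S³ × S³` is a (nonconstant, affinely parametrized) geodesic line of the metric `g`:
a regular smooth curve with `∇_{γ'} γ' = 0` for the Levi-Civita connection `∇` of `g`, where
`∇_{γ'} γ'` is computed at `γ t₀` as `∇_X X` for a vector field `X` that extends `γ'` near `t₀`. -/
def IsGeodesic (g : Amb → Amb → Amb → ℝ) (γ : ℝ → Amb) : Prop :=
  ContDiff ℝ ∞ γ ∧ (∀ t, γ t ∈ S3S3) ∧ (∀ t, deriv γ t ≠ 0) ∧
    ∃ D, IsLeviCivita g D ∧ ∀ t₀, ∃ X, IsVF X ∧ (∀ᶠ t in nhds t₀, X (γ t) = deriv γ t) ∧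
      D X X (γ t₀) = 0

/-- A geodesic line is closed if it is periodic. -/
def IsClosedCurve (γ : ℝ → Amb) : Prop := ∃ T : ℝ, 0 < T ∧ ∀ t, γ (t + T) = γ t

/-! ## The constants of a nearly Kähler geodesic

Write `γ' = (x α, y β)` for `γ = (x, y)`, with imaginary `α`, `β`. Then `c₁ = α + β`, which is
constant along `γ`; if `c₁ ≠ 0` then `d₁ = ⟨α - β, c₁⟩ / ‖c₁‖²`, again constant, and
`c₂ = ε(0)`, where `ε = α - β - d₁ c₁` is the part of `α - β` orthogonal to `c₁`. -/

/-- `α = x⁻¹ x'`. -/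
def alpha (γ : ℝ → Amb) (t : ℝ) : Quat := (γ t).1⁻¹ * (deriv γ t).1

/-- `β = y⁻¹ y'`. -/
def beta (γ : ℝ → Amb) (t : ℝ) : Quat := (γ t).2⁻¹ * (deriv γ t).2

def c₁ (γ : ℝ → Amb) : Quat := alpha γ 0 + beta γ 0

/-- Only meaningful if `c₁ ≠ 0`. -/
def d₁ (γ : ℝ → Amb) : ℝ := inner ℝ (alpha γ 0 - beta γ 0) (c₁ γ) / ‖c₁ γ‖ ^ 2

/-- Only meaningful if `c₁ ≠ 0`. -/
def c₂ (γ : ℝ → Amb) : Quat := alpha γ 0 - beta γ 0 - d₁ γ • c₁ γ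

/-! ## The explicit curves

Below `n₁`, `n₂` stand for `‖c₁‖`, `‖c₂‖`. -/

/-- `a = (1 + d₁) ‖c₁‖ / 2`. -/
def cA (n₁ d : ℝ) : ℝ := (1 + d) / 2 * n₁

/-- `ã = (1 - d₁) ‖c₁‖ / 2`. -/
def cA' (n₁ d : ℝ) : ℝ := (1 - d) / 2 * n₁

/-- `A = (c + √((2a - c)² + 4b²)) / 2`. -/
def freqA (a b c : ℝ) : ℝ := (c + √((2 * a - c) ^ 2 + 4 * b ^ 2)) / 2

/-- `B = (c - √((2a - c)² + 4b²)) / 2`. -/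
def freqB (a b c : ℝ) : ℝ := (c - √((2 * a - c) ^ 2 + 4 * b ^ 2)) / 2

/-- `φ = (c - 2a + √((c - 2a)² + 4b²)) / (2b)`. -/
def phi (a b c : ℝ) : ℝ := (c - 2 * a + √((c - 2 * a) ^ 2 + 4 * b ^ 2)) / (2 * b)

/-- `cos (a t) + sin (a t) i`. -/
def circ (a t : ℝ) : Quat := ⟨Real.cos (a * t), Real.sin (a * t), 0, 0⟩

/-- The factor curve of the generic case, with frequencies `A`, `B` and angle `φ`. -/
def twoFreq (A B φ t : ℝ) : Quat :=
  ⟨1 / (1 + φ ^ 2) * Real.cos (A * t) + φ ^ 2 / (1 + φ ^ 2) * Real.cos (B * t),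
   1 / (1 + φ ^ 2) * Real.sin (A * t) + φ ^ 2 / (1 + φ ^ 2) * Real.sin (B * t),
   φ / (1 + φ ^ 2) * Real.sin (A * t) - φ / (1 + φ ^ 2) * Real.sin (B * t),
   -(-(φ / (1 + φ ^ 2)) * Real.cos (A * t) + φ / (1 + φ ^ 2) * Real.cos (B * t))⟩

/-- The case `c₁ = 0`: `(cos at + sin at i, cos at - sin at i)`. -/
def curve1 (a t : ℝ) : Amb :=
  (⟨Real.cos (a * t), Real.sin (a * t), 0, 0⟩, ⟨Real.cos (a * t), -Real.sin (a * t), 0, 0⟩)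

/-- The case `c₁ ≠ 0`, `c₂ = 0`: `(cos at + sin at i, cos ãt + sin ãt i)`. -/
def curve2 (n₁ d t : ℝ) : Amb := (circ (cA n₁ d) t, circ (cA' n₁ d) t)

/-- The frequency `A` of the generic case: `b = ‖c₂‖ / 2`, `c = 2 ‖c₁‖ / 3`. -/
def fA (n₁ n₂ d : ℝ) : ℝ := freqA (cA n₁ d) (n₂ / 2) (2 / 3 * n₁)

/-- The frequency `B` of the generic case. -/
def fB (n₁ n₂ d : ℝ) : ℝ := freqB (cA n₁ d) (n₂ / 2) (2 / 3 * n₁)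

/-- The frequency `Ã` of the generic case: `b̃ = -‖c₂‖ / 2`, `c̃ = c`. -/
def fA' (n₁ n₂ d : ℝ) : ℝ := freqA (cA' n₁ d) (-(n₂ / 2)) (2 / 3 * n₁)

/-- The frequency `B̃` of the generic case. -/
def fB' (n₁ n₂ d : ℝ) : ℝ := freqB (cA' n₁ d) (-(n₂ / 2)) (2 / 3 * n₁)

/-- The generic case `c₁ ≠ 0`, `c₂ ≠ 0`. -/
def curve3 (n₁ n₂ d t : ℝ) : Amb :=
  (twoFreq (fA n₁ n₂ d) (fB n₁ n₂ d) (phi (cA n₁ d) (n₂ / 2) (2 / 3 * n₁)) t,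
   twoFreq (fA' n₁ n₂ d) (fB' n₁ n₂ d) (phi (cA' n₁ d) (-(n₂ / 2)) (2 / 3 * n₁)) t)

/-- `γ` has the parametrization `δ`, up to an isometry `(p, q) ↦ (u p h⁻¹, v q h⁻¹)` with unit
quaternions `u`, `v`, `h`. -/
def HasParam (γ δ : ℝ → Amb) : Prop :=
  ∃ u v h : Quat, ‖u‖ = 1 ∧ ‖v‖ = 1 ∧ ‖h‖ = 1 ∧
    ∀ t, γ t = (u * (δ t).1 * h⁻¹, v * (δ t).2 * h⁻¹)

/-- The fraction `r / s` is rational; the condition is void when the denominator vanishes. -/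
def RationalRatio (r s : ℝ) : Prop := s = 0 ∨ ∃ q : ℚ, r / s = q

end NKS3S3

end

/-! The maps `(p, q) ↦ (a p d, b q d)` with unit quaternions `a`, `b`, `d` are isometries of both
metrics, and Noether's theorem turns each one-parameter group of them into a quantity conserved
along geodesics. For `gNK` these quantities are `α + β = c₁`, `x (2α - β) x⁻¹` and `y (2β - α) y⁻¹`,
where `2α - β = 3α - c₁`.

Differentiating the second one gives `α' = [α, c₁] / 3` (`hasDerivAt_alpha`), so `α` is constant
exactly when `α(0)` commutes with `c₁`, that is, when `c₁ = 0` or `c₂ = 0`. A Euclidean geodesic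
conserves `x α x⁻¹`, which forces `α' = 0`; conversely, constant `α`, `β` make the acceleration
normal to `S³ × S³`. Since `P` swaps `α` and `β`, its eigenvector conditions become `β = ±α`.

Integrating instead, `x' = x α = (M / 3) x + x c₁ / 3` with `M` the conserved momentum: a linear
equation with constant coefficients, and likewise for `y`. In a frame with `c₁` along `i` and `c₂`
along `j` (`exists_frame`), `circ` and `twoFreq` solve it, which yields the parametrizations.

Closedness is then arithmetic of frequencies. In the generic case no condition links the two
factors: since `A + B = Ã + B̃ = c`, a factor with rational frequency ratio has a period that is a
nonzero integer multiple of `2π / c`, and two such periods have a common multiple. -/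

noncomputable section

namespace NKS3S3

/-! ## Noether's theorem for one-parameter groups of linear isometries -/

/-- A symmetric form on each tangent space, with the properties of a metric that are needed to
differentiate it along curves. -/
structure IsSmoothForm (g : Amb → Amb → Amb → ℝ) : Prop where
  symm : ∀ x Z Z', g x Z Z' = g x Z' Z
  zero_left : ∀ x Z, g x 0 Z = 0
  sub_right : ∀ x Z Z' Z'', g x Z (Z' - Z'') = g x Z Z' - g x Z Z''
  hasDerivAt_self : ∀ (x : Amb) (Y : ℝ → Amb) (Y' : Amb) (t : ℝ), HasDerivAt Y Y' t →
    HasDerivAt (fun s => g x (Y s) (Y s)) (2 * g x (Y t) Y') t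
  diff : ∀ Y Z : Amb → Amb, ContDiff ℝ ∞ Y → ContDiff ℝ ∞ Z → ∀ x ∈ S3S3,
    DifferentiableAt ℝ (fun y => g y (Y y) (Z y)) x

/-- A one-parameter family of maps of `ℍ × ℍ` that preserve `g` at the points of `S³ × S³`, with
infinitesimal generator `L`. -/
structure IsIsometricFlow (g : Amb → Amb → Amb → ℝ) (Φ : ℝ → Amb → Amb) (L : Amb →L[ℝ] Amb) :
    Prop where
  hasDerivAt : ∀ (Y : ℝ → Amb) (Y' : Amb), HasDerivAt Y Y' 0 →
    HasDerivAt (fun s => Φ s (Y s)) (L (Y 0) + Y') 0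
  zero : ∀ y, Φ 0 y = y
  neg_apply : ∀ s y, Φ (-s) (Φ s y) = y
  isometry : ∀ s, ∀ x ∈ S3S3, ∀ Z Z', g (Φ s x) (Φ s Z) (Φ s Z') = g x Z Z'

theorem hasDerivAt_fst {Y : ℝ → Amb} {Y' : Amb} {t : ℝ} (h : HasDerivAt Y Y' t) :
    HasDerivAt (fun s => (Y s).1) Y'.1 t :=
  (ContinuousLinearMap.fst ℝ Quat Quat).hasFDerivAt.comp_hasDerivAt t h

theorem hasDerivAt_snd {Y : ℝ → Amb} {Y' : Amb} {t : ℝ} (h : HasDerivAt Y Y' t) :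
    HasDerivAt (fun s => (Y s).2) Y'.2 t :=
  (ContinuousLinearMap.snd ℝ Quat Quat).hasFDerivAt.comp_hasDerivAt t h

theorem hasDerivAt_comp_neg {Y : ℝ → Amb} {Y' : Amb} (h : HasDerivAt Y Y' 0) :
    HasDerivAt (fun s => Y (-s)) (-Y') 0 := by
  have h1 : HasDerivAt Y Y' (-(0 : ℝ)) := by rwa [neg_zero]
  have h2 := HasDerivAt.scomp (0 : ℝ) h1 (hasDerivAt_neg (0 : ℝ))
  rw [neg_one_smul] at h2
  exact h2

/-- This is `L_L g = 0` evaluated on `(X, X)`: invariance moves `g` at `Φ s x` back to the fixed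
point `x`, where the derivative at `s = 0` falls on the vector alone. The right-hand side is `2 g(X,
[L, X])`. -/
theorem IsIsometricFlow.fderiv_apply {g : Amb → Amb → Amb → ℝ} {Φ : ℝ → Amb → Amb}
    {L : Amb →L[ℝ] Amb} (hg : IsSmoothForm g) (hΦ : IsIsometricFlow g Φ L) {X : Amb → Amb}
    (hX : ContDiff ℝ ∞ X) {x : Amb} (hx : x ∈ S3S3) :
    fderiv ℝ (fun y => g y (X y) (X y)) x (L x) =
      2 * g x (X x) (fderiv ℝ X x (L x) - L (X x)) := by
  have hc : HasDerivAt (fun s => Φ s x) (L x) 0 := by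
    simpa using hΦ.hasDerivAt (fun _ => x) 0 (hasDerivAt_const (0 : ℝ) x)
  have h0 : Φ 0 x = x := hΦ.zero x
  have hF : HasDerivAt (fun s => g (Φ s x) (X (Φ s x)) (X (Φ s x)))
      (fderiv ℝ (fun y => g y (X y) (X y)) x (L x)) 0 := by
    have h1 := (hg.diff X X hX hX x hx).hasFDerivAt
    rw [← h0] at h1
    have := h1.comp_hasDerivAt (0 : ℝ) hc
    rwa [h0] at this
  have hXc : HasDerivAt (fun s => X (Φ s x)) (fderiv ℝ X x (L x)) 0 := by
    have h1 := (hX.differentiable (by simp) x).hasFDerivAt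
    rw [← h0] at h1
    have := h1.comp_hasDerivAt (0 : ℝ) hc
    rwa [h0] at this
  -- The flow axiom differentiates `Φ s (Y s)`, whereas `Φ (-s)` is needed here; hence the
  -- reflection of `s` before and after.
  have hY := hasDerivAt_comp_neg (hΦ.hasDerivAt _ _ (hasDerivAt_comp_neg hXc))
  have hG := hg.hasDerivAt_self x _ _ _ hY
  have hEq : (fun s => g (Φ s x) (X (Φ s x)) (X (Φ s x))) =
      fun s => g x (Φ (-s) (X (Φ (- -s) x))) (Φ (-s) (X (Φ (- -s) x))) := by
    funext s
    have hs : Φ s (Φ (-s) (X (Φ s x))) = X (Φ s x) := by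
      simpa using hΦ.neg_apply (-s) (X (Φ s x))
    rw [neg_neg, ← hΦ.isometry s x hx, hs]
  rw [hEq] at hF
  rw [hF.unique hG]
  simp only [neg_zero, h0, hΦ.zero]
  congr 2
  abel

/-- Noether's theorem: the momentum of a geodesic along an infinitesimal isometry is constant. -/
theorem IsGeodesic.hasDerivAt_momentum {g : Amb → Amb → Amb → ℝ} {γ : ℝ → Amb}
    {Φ : ℝ → Amb → Amb} {L : Amb →L[ℝ] Amb} (hγ : IsGeodesic g γ) (hg : IsSmoothForm g)
    (hΦ : IsIsometricFlow g Φ L) (hL : IsVF L) (t : ℝ) :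
    HasDerivAt (fun t => g (γ t) (deriv γ t) (L (γ t))) 0 t := by
  obtain ⟨hs, hS, -, D, hD, hgeo⟩ := hγ
  obtain ⟨X, hX, hXγ, hDX⟩ := hgeo t
  have hx := hS t
  have hγ' : HasDerivAt γ (X (γ t)) t := by
    rw [hXγ.self_of_nhds]; exact (hs.differentiable (by simp) t).hasDerivAt
  have h1 := (hg.diff X L hX.1 hL.1 (γ t) hx).hasFDerivAt.comp_hasDerivAt t hγ'
  have hmet := hD.metric X X L hX hX hL (γ t) hx
  have hmet' := hD.metric L X X hL hX hX (γ t) hx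
  have htor := hD.torsion_free X L hX hL (γ t) hx
  have hflow := hΦ.fderiv_apply hg hX.1 hx
  -- As `∇_X X = 0`, the derivative is `g(X, ∇_X L) = g(X, ∇_L X) - g(X, [L, X])`, and both terms
  -- equal half of `L (g(X, X))`.
  have hzero : fderiv ℝ (fun y => g y (X y) (L y)) (γ t) (X (γ t)) = 0 := by
    rw [hflow, hg.symm _ (D L X (γ t))] at hmet'
    have hDL : D X L (γ t) = (D L X (γ t)) - (fderiv ℝ X (γ t) (L (γ t)) - L (X (γ t))) := by
      rw [← sub_add_cancel (D X L (γ t)) (D L X (γ t)), htor, VectorField.lieBracket,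
        ContinuousLinearMap.fderiv]
      abel
    rw [hmet, hDX, hDL, hg.zero_left, hg.sub_right]
    linarith
  rw [hzero] at h1
  refine h1.congr_of_eventuallyEq ?_
  filter_upwards [hXγ] with s hs
  simp [hs]

/-! ## Unit quaternions and the two metrics -/

theorem inner_mul_left_of_norm_eq_one {a : Quat} (ha : ‖a‖ = 1) (u v : Quat) :
    inner ℝ (a * u) (a * v) = (inner ℝ u v : ℝ) := by
  have h : Quaternion.normSq a = 1 := by rw [Quaternion.normSq_eq_norm_mul_self, ha]; norm_num
  rw [Quaternion.normSq_def'] at h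
  simp only [Quaternion.inner_def, Quaternion.re_mul, Quaternion.imI_mul, Quaternion.imJ_mul,
    Quaternion.imK_mul, Quaternion.re_star, Quaternion.imI_star, Quaternion.imJ_star,
    Quaternion.imK_star]
  linear_combination (u.re * v.re + u.imI * v.imI + u.imJ * v.imJ + u.imK * v.imK) * h

theorem inner_mul_right_of_norm_eq_one {a : Quat} (ha : ‖a‖ = 1) (u v : Quat) :
    inner ℝ (u * a) (v * a) = (inner ℝ u v : ℝ) := by
  have h : Quaternion.normSq a = 1 := by rw [Quaternion.normSq_eq_norm_mul_self, ha]; norm_num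
  rw [Quaternion.normSq_def'] at h
  simp only [Quaternion.inner_def, Quaternion.re_mul, Quaternion.imI_mul, Quaternion.imJ_mul,
    Quaternion.imK_mul, Quaternion.re_star, Quaternion.imI_star, Quaternion.imJ_star,
    Quaternion.imK_star]
  linear_combination (u.re * v.re + u.imI * v.imI + u.imJ * v.imJ + u.imK * v.imK) * h

theorem inv_eq_star {a : Quat} (ha : ‖a‖ = 1) : a⁻¹ = star a := by
  rw [Quaternion.inv_def, Quaternion.normSq_eq_norm_mul_self, ha]; simp

theorem ne_zero_of_norm_eq_one {a : Quat} (ha : ‖a‖ = 1) : a ≠ 0 := by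
  rintro rfl; simp at ha

theorem gE_isSmoothForm : IsSmoothForm gE where
  symm x Z Z' := by simp only [gE, real_inner_comm]
  zero_left x Z := by simp [gE]
  sub_right x Z Z' Z'' := by simp only [gE, Prod.fst_sub, Prod.snd_sub, inner_sub_right]; ring
  hasDerivAt_self x Y Y' t hY := by
    have h := ((hasDerivAt_fst hY).inner ℝ (hasDerivAt_fst hY)).fun_add
      ((hasDerivAt_snd hY).inner ℝ (hasDerivAt_snd hY))
    refine h.congr_deriv ?_
    rw [gE, real_inner_comm (Y t).1 Y'.1, real_inner_comm (Y t).2 Y'.2]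
    ring
  diff Y Z hY hZ x _ := by
    have h1 := hY.differentiable (by simp) x
    have h2 := hZ.differentiable (by simp) x
    exact (h1.fst.inner ℝ h2.fst).add (h1.snd.inner ℝ h2.snd)

/-- The almost complex structure at `x`, as a linear map of `ℍ × ℍ`. -/
def JCLM (x : Amb) : Amb →L[ℝ] Amb :=
  (1 / √3 : ℝ) • ((ContinuousLinearMap.mul ℝ Quat (2 * (x.1 * x.2⁻¹)) ∘L .snd ℝ Quat Quat -
      .fst ℝ Quat Quat).prod
    (-(ContinuousLinearMap.mul ℝ Quat (2 * (x.2 * x.1⁻¹)) ∘L .fst ℝ Quat Quat) +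
      .snd ℝ Quat Quat))

theorem JCLM_apply (x Z : Amb) : JCLM x Z = J x Z := by
  simp [JCLM, J, mul_assoc]

theorem differentiableAt_J {Y : Amb → Amb} (hY : ContDiff ℝ ∞ Y) {x : Amb} (hx : x ∈ S3S3) :
    DifferentiableAt ℝ (fun y => J y (Y y)) x := by
  have h1 := hY.differentiable (by simp) x
  have hi1 : DifferentiableAt ℝ (fun y : Amb => y.1⁻¹) x :=
    differentiableAt_fst.inv (ne_zero_of_norm_eq_one hx.1)
  have hi2 : DifferentiableAt ℝ (fun y : Amb => y.2⁻¹) x :=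
    differentiableAt_snd.inv (ne_zero_of_norm_eq_one hx.2)
  unfold J
  fun_prop

theorem gNK_isSmoothForm : IsSmoothForm gNK where
  symm x Z Z' := by simp only [gNK, gE_isSmoothForm.symm x Z, gE_isSmoothForm.symm x (J x Z)]
  zero_left x Z := by simp [gNK, gE_isSmoothForm.zero_left, ← JCLM_apply]
  sub_right x Z Z' Z'' := by
    simp only [gNK, ← JCLM_apply, map_sub, gE_isSmoothForm.sub_right]
    ring
  hasDerivAt_self x Y Y' t hY := by
    have h : HasDerivAt (fun s => J x (Y s)) (J x Y') t := by
      have h := (JCLM x).hasFDerivAt.comp_hasDerivAt t hY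
      simp only [JCLM_apply, Function.comp_def] at h
      exact h
    refine HasDerivAt.congr_deriv (((gE_isSmoothForm.hasDerivAt_self x _ _ t hY).fun_add
      (gE_isSmoothForm.hasDerivAt_self x _ _ t h)).const_mul (1 / 2)) ?_
    simp only [gNK]
    ring
  diff Y Z hY hZ x hx := by
    have h1 := hY.differentiable (by simp) x
    have h2 := hZ.differentiable (by simp) x
    have h3 := differentiableAt_J hY hx
    have h4 := differentiableAt_J hZ hx
    exact (((h1.fst.inner ℝ h2.fst).add (h1.snd.inner ℝ h2.snd)).add
      ((h3.fst.inner ℝ h4.fst).add (h3.snd.inner ℝ h4.snd))).const_mul _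

/-! ## Rotations -/

/-- A curve of unit quaternions that behaves at `0` like `s ↦ exp (s ξ)`. -/
structure IsRotation (a : ℝ → Quat) (ξ : Quat) : Prop where
  hasDerivAt : HasDerivAt a ξ 0
  zero : a 0 = 1
  norm : ∀ s, ‖a s‖ = 1
  neg_mul : ∀ s, a (-s) * a s = 1

theorem isRotation_one : IsRotation (fun _ => 1) 0 where
  hasDerivAt := hasDerivAt_const _ _
  zero := rfl
  norm := by simp
  neg_mul := by simp

theorem norm_eq_one_of_sq_sum {a : Quat} (h : a.re ^ 2 + a.imI ^ 2 + a.imJ ^ 2 + a.imK ^ 2 = 1) :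
    ‖a‖ = 1 := by
  have := Quaternion.normSq_eq_norm_mul_self a
  rw [Quaternion.normSq_def', h] at this
  nlinarith [norm_nonneg a]

theorem sq_sum_of_norm_eq_one {a : Quat} (h : ‖a‖ = 1) :
    a.re ^ 2 + a.imI ^ 2 + a.imJ ^ 2 + a.imK ^ 2 = 1 := by
  have := Quaternion.normSq_eq_norm_mul_self a
  rw [Quaternion.normSq_def', h] at this
  linarith

/-- An imaginary unit satisfies `ξ² = -1`, so the curve is `exp (s ξ)`. -/
theorem isRotation_cos_add_sin {ξ : Quat} (hre : ξ.re = 0) (hξ : ‖ξ‖ = 1) :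
    IsRotation (fun s => Real.cos s • (1 : Quat) + Real.sin s • ξ) ξ where
  hasDerivAt := by
    have := ((Real.hasDerivAt_cos 0).smul_const (1 : Quat)).add
      ((Real.hasDerivAt_sin 0).smul_const ξ)
    simp only [Real.sin_zero, Real.cos_zero, neg_zero, zero_smul, one_smul, zero_add] at this
    exact this
  zero := by simp
  norm s := by
    apply norm_eq_one_of_sq_sum
    have h := sq_sum_of_norm_eq_one hξ
    simp [hre] at h ⊢
    linear_combination Real.sin s ^ 2 * h + Real.cos_sq_add_sin_sq s
  neg_mul s := by
    have h := sq_sum_of_norm_eq_one hξ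
    simp only [hre] at h
    ext <;> simp [hre]
    · linear_combination Real.sin s ^ 2 * h + Real.cos_sq_add_sin_sq s
    all_goals ring

theorem IsRotation.re_eq_zero {a : ℝ → Quat} {ξ : Quat} (h : IsRotation a ξ) : ξ.re = 0 := by
  have h1 := h.hasDerivAt.inner ℝ h.hasDerivAt
  have h2 : (fun s => inner ℝ (a s) (a s)) = fun _ => (1 : ℝ) := by
    funext s; rw [real_inner_self_eq_norm_sq, h.norm]; norm_num
  rw [h2] at h1
  have := h1.unique (hasDerivAt_const _ _)
  simp [h.zero, Quaternion.inner_def] at this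
  linarith

/-- The linear map `(p, q) ↦ (a p d, b q d)`. -/
def bimul (a b d : Quat) : Amb →L[ℝ] Amb :=
  (ContinuousLinearMap.mulLeftRight ℝ Quat a d ∘L .fst ℝ Quat Quat).prod
    (ContinuousLinearMap.mulLeftRight ℝ Quat b d ∘L .snd ℝ Quat Quat)

@[simp] theorem bimul_apply (a b d : Quat) (x : Amb) :
    bimul a b d x = (a * x.1 * d, b * x.2 * d) := by
  simp [bimul]

/-- The infinitesimal version `(p, q) ↦ (ξ p + p ζ, η q + q ζ)` of `bimul`. -/
def bimulGen (ξ η ζ : Quat) : Amb →L[ℝ] Amb :=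
  bimul ξ η 1 + bimul 1 1 ζ

theorem bimulGen_apply (ξ η ζ : Quat) (x : Amb) :
    bimulGen ξ η ζ x = (ξ * x.1 + x.1 * ζ, η * x.2 + x.2 * ζ) := by
  simp [bimulGen]

theorem hasDerivAt_bimul {a b d : ℝ → Quat} {ξ η ζ : Quat} (ha : IsRotation a ξ)
    (hb : IsRotation b η) (hd : IsRotation d ζ) {Y : ℝ → Amb} {Y' : Amb}
    (hY : HasDerivAt Y Y' 0) :
    HasDerivAt (fun s => bimul (a s) (b s) (d s) (Y s)) (bimulGen ξ η ζ (Y 0) + Y') 0 := by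
  have h := ((ha.hasDerivAt.fun_mul (hasDerivAt_fst hY)).fun_mul hd.hasDerivAt).prodMk
    ((hb.hasDerivAt.fun_mul (hasDerivAt_snd hY)).fun_mul hd.hasDerivAt)
  simp only [ha.zero, hb.zero, hd.zero, mul_one, one_mul] at h
  convert h using 1
  · funext s
    simp
  · ext1 <;> simp [bimulGen_apply] <;> abel

theorem gE_bimul {a b d : Quat} (ha : ‖a‖ = 1) (hb : ‖b‖ = 1) (hd : ‖d‖ = 1) (x y Z Z' : Amb) :
    gE y (bimul a b d Z) (bimul a b d Z') = gE x Z Z' := by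
  simp [gE, inner_mul_right_of_norm_eq_one hd, inner_mul_left_of_norm_eq_one ha,
    inner_mul_left_of_norm_eq_one hb]

/-- In `p q⁻¹ V` the factor `d` cancels between `p` and `q⁻¹`, and `b` between `q⁻¹` and `V`. This
is why the right factor has to be common to both spheres while the left factors are independent. -/
theorem J_bimul {a b d : Quat} (ha : a ≠ 0) (hb : b ≠ 0) (hd : d ≠ 0) (x Z : Amb) :
    J (bimul a b d x) (bimul a b d Z) = bimul a b d (J x Z) := by
  simp only [J, bimul_apply, mul_inv_rev, mul_assoc,
    mul_inv_cancel_left₀ hd, inv_mul_cancel_left₀ ha, inv_mul_cancel_left₀ hb, Prod.smul_mk,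
    mul_smul_comm, smul_mul_assoc, mul_sub, mul_add, sub_mul, add_mul, mul_neg, neg_mul,
    two_mul]

theorem gNK_bimul {a b d : Quat} (ha : ‖a‖ = 1) (hb : ‖b‖ = 1) (hd : ‖d‖ = 1) (x Z Z' : Amb) :
    gNK (bimul a b d x) (bimul a b d Z) (bimul a b d Z') = gNK x Z Z' := by
  simp only [gNK, J_bimul (ne_zero_of_norm_eq_one ha) (ne_zero_of_norm_eq_one hb)
    (ne_zero_of_norm_eq_one hd), gE_bimul ha hb hd x]

theorem isVF_bimulGen {ξ η ζ : Quat} (hξ : ξ.re = 0) (hη : η.re = 0) (hζ : ζ.re = 0) :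
    IsVF (bimulGen ξ η ζ) := by
  refine ⟨(bimulGen ξ η ζ).contDiff, fun x _ => ?_⟩
  have key : ∀ (ξ p : Quat), ξ.re = 0 → inner ℝ (ξ * p + p * ζ) p = (0 : ℝ) := by
    intro ξ p h
    simp [Quaternion.inner_def, h, hζ]
    ring
  rw [bimulGen_apply]
  exact ⟨key ξ x.1 hξ, key η x.2 hη⟩

theorem isIsometricFlow_bimul {g : Amb → Amb → Amb → ℝ}
    (hg : ∀ a b d : Quat, ‖a‖ = 1 → ‖b‖ = 1 → ‖d‖ = 1 → ∀ x Z Z',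
      g (bimul a b d x) (bimul a b d Z) (bimul a b d Z') = g x Z Z')
    {a b d : ℝ → Quat} {ξ η ζ : Quat} (ha : IsRotation a ξ)
    (hb : IsRotation b η) (hd : IsRotation d ζ) :
    IsIsometricFlow g (fun s => bimul (a s) (b s) (d s)) (bimulGen ξ η ζ) where
  hasDerivAt Y Y' hY := hasDerivAt_bimul ha hb hd hY
  zero y := by simp [ha.zero, hb.zero, hd.zero]
  neg_apply s y := by
    have h := hd.neg_mul (-s)
    rw [neg_neg] at h
    simp only [bimul_apply, mul_assoc, h]
    simp only [← mul_assoc, ha.neg_mul, hb.neg_mul, one_mul, mul_one]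
  isometry s x _ Z Z' := hg _ _ _ (ha.norm s) (hb.norm s) (hd.norm s) x Z Z'

/-! ## Left-trivialized curves and conserved quantities -/

theorem star_mul_self_of_norm_eq_one {a : Quat} (ha : ‖a‖ = 1) : star a * a = 1 := by
  rw [← inv_eq_star ha, inv_mul_cancel₀ (ne_zero_of_norm_eq_one ha)]

theorem self_mul_star_of_norm_eq_one {a : Quat} (ha : ‖a‖ = 1) : a * star a = 1 := by
  rw [← inv_eq_star ha, mul_inv_cancel₀ (ne_zero_of_norm_eq_one ha)]

theorem fst_mul_alpha {γ : ℝ → Amb} (hS : ∀ t, γ t ∈ S3S3) (t : ℝ) :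
    (γ t).1 * alpha γ t = (deriv γ t).1 := by
  rw [alpha, mul_inv_cancel_left₀ (ne_zero_of_norm_eq_one (hS t).1)]

theorem snd_mul_beta {γ : ℝ → Amb} (hS : ∀ t, γ t ∈ S3S3) (t : ℝ) :
    (γ t).2 * beta γ t = (deriv γ t).2 := by
  rw [beta, mul_inv_cancel_left₀ (ne_zero_of_norm_eq_one (hS t).2)]

theorem hasDerivAt_fst_mul_alpha {γ : ℝ → Amb} (hs : ContDiff ℝ ∞ γ) (hS : ∀ t, γ t ∈ S3S3)
    (t : ℝ) : HasDerivAt (fun t => (γ t).1) ((γ t).1 * alpha γ t) t := by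
  rw [fst_mul_alpha hS]
  exact hasDerivAt_fst (hs.differentiable (by simp) t).hasDerivAt

theorem hasDerivAt_snd_mul_beta {γ : ℝ → Amb} (hs : ContDiff ℝ ∞ γ) (hS : ∀ t, γ t ∈ S3S3)
    (t : ℝ) : HasDerivAt (fun t => (γ t).2) ((γ t).2 * beta γ t) t := by
  rw [snd_mul_beta hS]
  exact hasDerivAt_snd (hs.differentiable (by simp) t).hasDerivAt

theorem re_eq_zero_of_hasDerivAt {x : ℝ → Quat} {a : Quat} {t : ℝ} (hx : ∀ t, ‖x t‖ = 1)
    (h : HasDerivAt x (x t * a) t) : a.re = 0 := by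
  have h1 := h.inner ℝ h
  have h2 : (fun s => inner ℝ (x s) (x s)) = fun _ => (1 : ℝ) := by
    funext s; rw [real_inner_self_eq_norm_sq, hx]; norm_num
  rw [h2, real_inner_comm (x t)] at h1
  have h3 := h1.unique (hasDerivAt_const _ _)
  have h4 : inner ℝ (x t) (x t * a) = a.re := by
    have := inner_mul_left_of_norm_eq_one (hx t) a 1
    rw [mul_one, real_inner_comm] at this
    rw [this]
    simp [Quaternion.inner_def]
  linarith

theorem re_alpha {γ : ℝ → Amb} (hs : ContDiff ℝ ∞ γ) (hS : ∀ t, γ t ∈ S3S3) (t : ℝ) :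
    (alpha γ t).re = 0 :=
  re_eq_zero_of_hasDerivAt (fun t => (hS t).1) (hasDerivAt_fst_mul_alpha hs hS t)

theorem re_beta {γ : ℝ → Amb} (hs : ContDiff ℝ ∞ γ) (hS : ∀ t, γ t ∈ S3S3) (t : ℝ) :
    (beta γ t).re = 0 :=
  re_eq_zero_of_hasDerivAt (fun t => (hS t).2) (hasDerivAt_snd_mul_beta hs hS t)

theorem gE_trivialized {x : Amb} (hx : x ∈ S3S3) (a b a' b' : Quat) :
    gE x (x.1 * a, x.2 * b) (x.1 * a', x.2 * b') = inner ℝ a a' + inner ℝ b b' := by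
  simp only [gE, inner_mul_left_of_norm_eq_one hx.1, inner_mul_left_of_norm_eq_one hx.2]

theorem J_trivialized {x : Amb} (hx : x ∈ S3S3) (a b : Quat) :
    J x (x.1 * a, x.2 * b) = (x.1 * ((1 / √3 : ℝ) • (2 * b - a)),
      x.2 * ((1 / √3 : ℝ) • (b - 2 * a))) := by
  simp only [J, mul_assoc, inv_mul_cancel_left₀ (ne_zero_of_norm_eq_one hx.1),
    inv_mul_cancel_left₀ (ne_zero_of_norm_eq_one hx.2), Prod.smul_mk, mul_smul_comm, mul_sub,
    two_mul, mul_add, neg_add_eq_sub]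

/-- The nearly Kähler metric in the left-invariant frame. -/
theorem gNK_trivialized {x : Amb} (hx : x ∈ S3S3) (a b a' b' : Quat) :
    gNK x (x.1 * a, x.2 * b) (x.1 * a', x.2 * b') =
      4 / 3 * (inner ℝ a a' + inner ℝ b b') - 2 / 3 * (inner ℝ a b' + inner ℝ b a') := by
  rw [gNK, J_trivialized hx, J_trivialized hx, gE_trivialized hx, gE_trivialized hx]
  simp only [real_inner_smul_left, real_inner_smul_right, two_mul, inner_sub_left, inner_add_left,
    inner_sub_right, inner_add_right]
  have h : (1 / √3 : ℝ) * (1 / √3) = 1 / 3 := by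
    rw [div_mul_div_comm, Real.mul_self_sqrt (by norm_num)]; norm_num
  -- Here `⟨2b - a, 2b' - a'⟩ + ⟨b - 2a, b' - 2a'⟩` equals five times the diagonal terms minus four
  -- times the mixed ones.
  linear_combination (5 / 2 * (inner ℝ a a' + inner ℝ b b') -
    2 * (inner ℝ a b' + inner ℝ b a') : ℝ) * h

theorem P_trivialized {x : Amb} (hx : x ∈ S3S3) (a b : Quat) :
    P x (x.1 * a, x.2 * b) = (x.1 * b, x.2 * a) := by
  simp only [P, mul_assoc, inv_mul_cancel_left₀ (ne_zero_of_norm_eq_one hx.1),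
    inv_mul_cancel_left₀ (ne_zero_of_norm_eq_one hx.2)]

theorem deriv_trivialized {γ : ℝ → Amb} (hS : ∀ t, γ t ∈ S3S3) (t : ℝ) :
    deriv γ t = ((γ t).1 * alpha γ t, (γ t).2 * beta γ t) :=
  Prod.ext (fst_mul_alpha hS t).symm (snd_mul_beta hS t).symm

theorem bimulGen_trivialized {x : Amb} (hx : x ∈ S3S3) (ξ η ζ : Quat) :
    bimulGen ξ η ζ x = (x.1 * (star x.1 * ξ * x.1 + ζ), x.2 * (star x.2 * η * x.2 + ζ)) := by
  rw [bimulGen_apply]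
  simp only [mul_add, ← mul_assoc, self_mul_star_of_norm_eq_one hx.1,
    self_mul_star_of_norm_eq_one hx.2, one_mul]

theorem inner_conj (x a ξ : Quat) :
    inner ℝ a (star x * ξ * x) = (inner ℝ (x * a * star x) ξ : ℝ) := by
  simp only [Quaternion.inner_def, Quaternion.re_mul, Quaternion.imI_mul, Quaternion.imJ_mul,
    Quaternion.imK_mul, Quaternion.re_star, Quaternion.imI_star, Quaternion.imJ_star,
    Quaternion.imK_star]
  ring

theorem re_conj {x a : Quat} (ha : a.re = 0) : (x * a * star x).re = 0 := by
  simp [ha]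
  ring

/-- An imaginary curve whose components are all constant is constant. -/
theorem eq_of_hasDerivAt_inner {m : ℝ → Quat} (hre : ∀ t, (m t).re = 0)
    (h : ∀ ξ : Quat, ξ.re = 0 → ‖ξ‖ = 1 → ∀ t, HasDerivAt (fun t => inner ℝ (m t) ξ) (0 : ℝ) t)
    (t : ℝ) : m t = m 0 := by
  by_contra hne
  have hw : m t - m 0 ≠ 0 := sub_ne_zero.mpr hne
  have hn : ‖m t - m 0‖ ≠ 0 := norm_ne_zero_iff.mpr hw
  set w := m t - m 0 with hwdef
  -- The test direction is that of the difference `w` itself, so its constant component yields `‖w‖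
  -- = 0`.
  have hξ := h (‖w‖⁻¹ • w) (by simp [hwdef, hre])
    (by rw [norm_smul, norm_inv, norm_norm, inv_mul_cancel₀ hn])
  have hc := is_const_of_deriv_eq_zero (fun t => (hξ t).differentiableAt)
    (fun t => (hξ t).deriv) t 0
  rw [← sub_eq_zero, ← inner_sub_left, ← hwdef, real_inner_smul_right,
    real_inner_self_eq_norm_sq] at hc
  have : ‖w‖⁻¹ * ‖w‖ ^ 2 ≠ 0 := by positivity
  exact this hc

section Momenta

variable {g : Amb → Amb → Amb → ℝ} {γ : ℝ → Amb}

theorem IsGeodesic.hasDerivAt_bimulGen (hγ : IsGeodesic g γ) (hg : IsSmoothForm g)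
    (hinv : ∀ a b d : Quat, ‖a‖ = 1 → ‖b‖ = 1 → ‖d‖ = 1 → ∀ x Z Z',
      g (bimul a b d x) (bimul a b d Z) (bimul a b d Z') = g x Z Z')
    {a b d : ℝ → Quat} {ξ η ζ : Quat} (ha : IsRotation a ξ)
    (hb : IsRotation b η) (hd : IsRotation d ζ) (t : ℝ) :
    HasDerivAt (fun t => g (γ t) ((γ t).1 * alpha γ t, (γ t).2 * beta γ t)
      ((γ t).1 * (star (γ t).1 * ξ * (γ t).1 + ζ), (γ t).2 * (star (γ t).2 * η * (γ t).2 + ζ)))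
      0 t := by
  have := hγ.hasDerivAt_momentum hg (isIsometricFlow_bimul hinv ha hb hd)
    (isVF_bimulGen ha.re_eq_zero hb.re_eq_zero hd.re_eq_zero) t
  simpa only [deriv_trivialized hγ.2.1, bimulGen_trivialized (hγ.2.1 _)] using this

/-- The momentum of common right multiplication by `exp (s ξ)`, with field `(x ξ, y ξ)`, is `(2/3)
⟨α + β, ξ⟩`. -/
theorem alpha_add_beta (hγ : IsGeodesic gNK γ) (t : ℝ) : alpha γ t + beta γ t = c₁ γ := by
  refine eq_of_hasDerivAt_inner (m := fun t => alpha γ t + beta γ t)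
    (fun t => by simp [re_alpha hγ.1 hγ.2.1, re_beta hγ.1 hγ.2.1]) (fun ξ hξ hn t => ?_) t
  have h := (hγ.hasDerivAt_bimulGen gNK_isSmoothForm (fun a b d ha hb hd => gNK_bimul ha hb hd)
    isRotation_one isRotation_one (isRotation_cos_add_sin hξ hn) t).const_mul (3 / 2)
  simp only [gNK_trivialized (hγ.2.1 _), mul_zero, zero_mul, zero_add] at h
  refine h.congr_of_eventuallyEq (.of_forall fun s => ?_)
  beta_reduce
  rw [inner_add_left]
  ring

/-- Left multiplication of the first factor has field `(x (x⁻¹ ξ x), 0)` and momentum `(2/3) ⟨2α -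
β, x⁻¹ ξ x⟩`; conjugation is moved to the other side of the inner product. -/
theorem momentum_fst (hγ : IsGeodesic gNK γ) (t : ℝ) :
    (γ t).1 * (2 * alpha γ t - beta γ t) * star (γ t).1 =
      (γ 0).1 * (2 * alpha γ 0 - beta γ 0) * star (γ 0).1 := by
  refine eq_of_hasDerivAt_inner
    (m := fun t => (γ t).1 * (2 * alpha γ t - beta γ t) * star (γ t).1)
    (fun t => re_conj (by simp [two_mul, re_alpha hγ.1 hγ.2.1, re_beta hγ.1 hγ.2.1]))
    (fun ξ hξ hn t => ?_) t
  have h := (hγ.hasDerivAt_bimulGen gNK_isSmoothForm (fun a b d ha hb hd => gNK_bimul ha hb hd)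
    (isRotation_cos_add_sin hξ hn) isRotation_one isRotation_one t).const_mul (3 / 2)
  simp only [gNK_trivialized (hγ.2.1 _)] at h
  simp only [mul_zero, zero_mul, add_zero, inner_zero_right] at h
  refine h.congr_of_eventuallyEq (.of_forall fun s => ?_)
  beta_reduce
  rw [← inner_conj, two_mul, inner_sub_left, inner_add_left]
  ring

theorem momentum_snd (hγ : IsGeodesic gNK γ) (t : ℝ) :
    (γ t).2 * (2 * beta γ t - alpha γ t) * star (γ t).2 =
      (γ 0).2 * (2 * beta γ 0 - alpha γ 0) * star (γ 0).2 := by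
  refine eq_of_hasDerivAt_inner
    (m := fun t => (γ t).2 * (2 * beta γ t - alpha γ t) * star (γ t).2)
    (fun t => re_conj (by simp [two_mul, re_alpha hγ.1 hγ.2.1, re_beta hγ.1 hγ.2.1]))
    (fun ξ hξ hn t => ?_) t
  have h := (hγ.hasDerivAt_bimulGen gNK_isSmoothForm (fun a b d ha hb hd => gNK_bimul ha hb hd)
    isRotation_one (isRotation_cos_add_sin hξ hn) isRotation_one t).const_mul (3 / 2)
  simp only [gNK_trivialized (hγ.2.1 _)] at h
  simp only [mul_zero, zero_mul, add_zero, inner_zero_right] at h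
  refine h.congr_of_eventuallyEq (.of_forall fun s => ?_)
  beta_reduce
  rw [← inner_conj, two_mul, inner_sub_left, inner_add_left]
  ring

theorem momentum_fst_gE (hγ : IsGeodesic gE γ) (t : ℝ) :
    (γ t).1 * alpha γ t * star (γ t).1 = (γ 0).1 * alpha γ 0 * star (γ 0).1 := by
  refine eq_of_hasDerivAt_inner (m := fun t => (γ t).1 * alpha γ t * star (γ t).1)
    (fun t => re_conj (re_alpha hγ.1 hγ.2.1 t)) (fun ξ hξ hn t => ?_) t
  have h := hγ.hasDerivAt_bimulGen gE_isSmoothForm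
    (fun a b d ha hb hd x Z Z' => gE_bimul ha hb hd x _ Z Z')
    (isRotation_cos_add_sin hξ hn) isRotation_one isRotation_one t
  simp only [gE_trivialized (hγ.2.1 _)] at h
  simp only [mul_zero, zero_mul, add_zero, inner_zero_right] at h
  simpa only [← inner_conj] using h

theorem hasDerivAt_star {x : ℝ → Quat} {x' : Quat} {t : ℝ} (h : HasDerivAt x x' t) :
    HasDerivAt (fun t => star (x t)) (star x') t := by
  have : StarModule ℝ Quat := ⟨fun r q => by rw [Quaternion.star_smul]; rfl⟩
  exact h.star

/-- Differentiate `w = x⁻¹ M x` with `x' = x a`. Taking `w = a` gives `a' = 0`, which is the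
Euclidean case. -/
theorem hasDerivAt_of_conj_eq {x a w : ℝ → Quat} {M : Quat} (hn : ∀ t, ‖x t‖ = 1)
    (hx : ∀ t, HasDerivAt x (x t * a t) t) (hM : ∀ t, x t * w t * star (x t) = M) (t : ℝ) :
    HasDerivAt w (w t * a t - a t * w t) t := by
  have hw : ∀ t, w t = star (x t) * M * x t := fun t => by
    have h1 := star_mul_self_of_norm_eq_one (hn t)
    rw [← hM t]
    simp only [mul_assoc, h1, mul_one]
    rw [← mul_assoc, h1, one_mul]
  have hstar : star (a t) = -a t := by
    have := re_eq_zero_of_hasDerivAt hn (hx t)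
    ext <;> simp [this]
  have h := ((hasDerivAt_star (hx t)).mul_const M).fun_mul (hx t)
  rw [← funext hw] at h
  refine h.congr_deriv ?_
  rw [star_mul, hstar, hw t]
  noncomm_ring

/-- The equation of motion of `α` along a nearly Kähler geodesic. -/
theorem hasDerivAt_alpha (hγ : IsGeodesic gNK γ) (t : ℝ) :
    HasDerivAt (alpha γ) ((1 / 3 : ℝ) • (alpha γ t * c₁ γ - c₁ γ * alpha γ t)) t := by
  have h := hasDerivAt_of_conj_eq (fun t => (hγ.2.1 t).1)
    (hasDerivAt_fst_mul_alpha hγ.1 hγ.2.1) (momentum_fst hγ) t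
  have hb : ∀ t, beta γ t = c₁ γ - alpha γ t := fun t => by rw [← alpha_add_beta hγ t]; abel
  have ha : alpha γ = fun t => (1 / 3 : ℝ) • ((2 * alpha γ t - beta γ t) + c₁ γ) := by
    funext t
    rw [hb, two_mul, show alpha γ t + alpha γ t - (c₁ γ - alpha γ t) + c₁ γ = (3 : ℝ) • alpha γ t by
      module, smul_smul]
    norm_num
  -- With `w = 2α - β = 3α - c₁`, the squares of `α` cancel in `w α - α w`, leaving `α c₁ - c₁ α`.
  have h' := (h.add_const (c₁ γ)).const_smul (1 / 3 : ℝ)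
  refine (h'.congr_of_eventuallyEq (.of_forall (congrFun ha))).congr_deriv ?_
  rw [hb, two_mul]
  congr 1
  noncomm_ring

end Momenta

/-! ## The Levi-Civita connection of the Euclidean product metric -/

/-- The orthogonal projection to the tangent space at `x ∈ S³ × S³`. -/
def tangentProj (x Z : Amb) : Amb :=
  (Z.1 - (inner ℝ Z.1 x.1 : ℝ) • x.1, Z.2 - (inner ℝ Z.2 x.2 : ℝ) • x.2)

/-- The Levi-Civita connection of the Euclidean product metric. -/
def euclideanConnection (X Y : Amb → Amb) (x : Amb) : Amb :=
  tangentProj x (fderiv ℝ Y x (X x))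

theorem tangentProj_eq_self {x Z : Amb} (hZ : Z ∈ tangentAt x) : tangentProj x Z = Z := by
  simp [tangentProj, hZ.1, hZ.2]

theorem tangentProj_add (x Z Z' : Amb) :
    tangentProj x (Z + Z') = tangentProj x Z + tangentProj x Z' := by
  ext1 <;> simp only [tangentProj, Prod.fst_add, Prod.snd_add, inner_add_left, add_smul] <;> abel

theorem tangentProj_smul (x : Amb) (r : ℝ) (Z : Amb) :
    tangentProj x (r • Z) = r • tangentProj x Z := by
  ext1 <;> simp only [tangentProj, Prod.smul_fst, Prod.smul_snd, inner_smul_left, smul_sub,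
    smul_smul, RCLike.conj_to_real]

theorem tangentProj_sub (x Z Z' : Amb) :
    tangentProj x (Z - Z') = tangentProj x Z - tangentProj x Z' := by
  ext1 <;> simp only [tangentProj, Prod.fst_sub, Prod.snd_sub, inner_sub_left, sub_smul] <;> abel

theorem tangentProj_mem {x : Amb} (hx : x ∈ S3S3) (Z : Amb) : tangentProj x Z ∈ tangentAt x := by
  constructor <;>
    simp [tangentProj, inner_sub_left, real_inner_smul_left, hx.1, hx.2]

theorem gE_tangentProj {x Z' : Amb} (Z : Amb) (hZ' : Z' ∈ tangentAt x) :
    gE x (tangentProj x Z) Z' = gE x Z Z' := by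
  simp [gE, tangentProj, inner_sub_left, real_inner_smul_left, real_inner_comm _ x.1,
    real_inner_comm _ x.2, hZ'.1, hZ'.2]

/-- The curve `s ↦ (p + s U) / ‖p + s U‖` on the sphere. -/
theorem exists_curve_sphere {p U : Quat} (hp : ‖p‖ = 1) (hU : inner ℝ U p = (0 : ℝ)) :
    ∃ c : ℝ → Quat, c 0 = p ∧ (∀ s, ‖c s‖ = 1) ∧ HasDerivAt c U 0 := by
  have hpos : ∀ s : ℝ, 0 < 1 + s ^ 2 * ‖U‖ ^ 2 := fun s => by positivity
  have hnorm : ∀ s : ℝ, ‖p + s • U‖ = √(1 + s ^ 2 * ‖U‖ ^ 2) := fun s => by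
    rw [eq_comm, Real.sqrt_eq_iff_mul_self_eq (hpos s).le (norm_nonneg _), ← sq,
      norm_add_sq_real, real_inner_smul_right, real_inner_comm, hU, norm_smul, mul_pow, hp,
      Real.norm_eq_abs, sq_abs]
    ring
  refine ⟨fun s => (√(1 + s ^ 2 * ‖U‖ ^ 2))⁻¹ • (p + s • U), by simp, fun s => ?_, ?_⟩
  · rw [norm_smul, hnorm, norm_inv, Real.norm_of_nonneg (Real.sqrt_nonneg _),
      inv_mul_cancel₀ (Real.sqrt_pos.mpr (hpos s)).ne']
  · have h1 : HasDerivAt (fun s : ℝ => 1 + s ^ 2 * ‖U‖ ^ 2) 0 0 := by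
      simpa using (((hasDerivAt_id (0 : ℝ)).pow 2).mul_const (‖U‖ ^ 2)).const_add 1
    have h2 := (h1.sqrt (hpos 0).ne').fun_inv (by simp)
    have h3 : HasDerivAt (fun s : ℝ => p + s • U) U 0 := by
      simpa using ((hasDerivAt_id (0 : ℝ)).smul_const U).const_add p
    have h4 := h2.fun_smul h3
    simp only [zero_div, neg_zero, zero_smul, add_zero, ne_eq, OfNat.ofNat_ne_zero,
      not_false_eq_true, zero_pow, zero_mul, Real.sqrt_one, inv_one, one_smul] at h4
    exact h4

/-- Tangency of a field is known only on `S³ × S³`, so it can be differentiated only along curves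
that stay there. -/
theorem exists_curve {x Z : Amb} (hx : x ∈ S3S3) (hZ : Z ∈ tangentAt x) :
    ∃ c : ℝ → Amb, c 0 = x ∧ (∀ s, c s ∈ S3S3) ∧ HasDerivAt c Z 0 := by
  obtain ⟨c, hc0, hc, hc'⟩ := exists_curve_sphere hx.1 hZ.1
  obtain ⟨d, hd0, hd, hd'⟩ := exists_curve_sphere hx.2 hZ.2
  exact ⟨fun s => (c s, d s), Prod.ext hc0 hd0, fun s => ⟨hc s, hd s⟩, hc'.prodMk hd'⟩

/-- Differentiate `⟨Y, x⟩ = 0` along a curve with velocity `X`. The second term is symmetric in `X`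
and `Y`, so it drops out of the Lie bracket. -/
theorem inner_fderiv_add_eq_zero {X Y : Amb → Amb} (hX : IsVF X) (hY : IsVF Y) {x : Amb}
    (hx : x ∈ S3S3) :
    inner ℝ (fderiv ℝ Y x (X x)).1 x.1 + inner ℝ (Y x).1 (X x).1 = (0 : ℝ) ∧
      inner ℝ (fderiv ℝ Y x (X x)).2 x.2 + inner ℝ (Y x).2 (X x).2 = (0 : ℝ) := by
  obtain ⟨c, hc0, hc, hc'⟩ := exists_curve hx (hX.2 x hx)
  have hYc : HasDerivAt (fun s => Y (c s)) (fderiv ℝ Y x (X x)) 0 := by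
    have h1 := (hY.1.differentiable (by simp) x).hasFDerivAt
    rw [← hc0] at h1
    have := h1.comp_hasDerivAt (0 : ℝ) hc'
    rwa [hc0] at this
  have h1 := (hasDerivAt_fst hYc).inner ℝ (hasDerivAt_fst hc')
  have h2 := (hasDerivAt_snd hYc).inner ℝ (hasDerivAt_snd hc')
  rw [funext fun s => (hY.2 _ (hc s)).1, hc0] at h1
  rw [funext fun s => (hY.2 _ (hc s)).2, hc0] at h2
  have h1' := h1.unique (hasDerivAt_const _ _)
  have h2' := h2.unique (hasDerivAt_const _ _)
  exact ⟨by linarith, by linarith⟩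

theorem lieBracket_mem_tangentAt {X Y : Amb → Amb} (hX : IsVF X) (hY : IsVF Y) {x : Amb}
    (hx : x ∈ S3S3) : VectorField.lieBracket ℝ X Y x ∈ tangentAt x := by
  have h1 := inner_fderiv_add_eq_zero hX hY hx
  have h2 := inner_fderiv_add_eq_zero hY hX hx
  rw [real_inner_comm (X x).1, real_inner_comm (X x).2] at h1
  constructor
  · simp only [VectorField.lieBracket, Prod.fst_sub, inner_sub_left]
    linarith [h1.1, h2.1]
  · simp only [VectorField.lieBracket, Prod.snd_sub, inner_sub_left]
    linarith [h1.2, h2.2]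

theorem isVF_euclideanConnection {X Y : Amb → Amb} (hX : IsVF X) (hY : IsVF Y) :
    IsVF (euclideanConnection X Y) := by
  refine ⟨?_, fun x hx => tangentProj_mem hx _⟩
  have h : ContDiff ℝ ∞ fun x => fderiv ℝ Y x (X x) :=
    (hY.1.fderiv_right (by simp)).clm_apply hX.1
  exact (h.fst.sub ((h.fst.inner ℝ contDiff_fst).smul contDiff_fst)).prodMk
    (h.snd.sub ((h.snd.inner ℝ contDiff_snd).smul contDiff_snd))

/-- Being a geodesic requires a connection to exist. Torsion vanishes because the bracket of tangent
fields is tangent, hence unchanged by the projection; compatibility holds because the discarded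
normal part is orthogonal to tangent fields. -/
theorem isLeviCivita_euclideanConnection : IsLeviCivita gE euclideanConnection where
  isVF X Y hX hY := isVF_euclideanConnection hX hY
  add_left X X' Y _ _ _ x _ := by simp only [euclideanConnection, map_add, tangentProj_add]
  smul_left f X Y _ _ _ x _ := by simp only [euclideanConnection, map_smul, tangentProj_smul]
  add_right X Y Y' _ hY hY' x _ := by
    simp only [euclideanConnection]
    rw [fderiv_fun_add (hY.1.differentiable (by simp) x) (hY'.1.differentiable (by simp) x),
      add_apply, tangentProj_add]
  leibniz f X Y hf _ hY x hx := by
    have h := ((hf.differentiable (by simp) x).hasFDerivAt.smul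
      (hY.1.differentiable (by simp) x).hasFDerivAt).fderiv
    simp only [euclideanConnection]
    rw [show (fun y => f y • Y y) = f • Y from rfl, h, add_apply,
      tangentProj_add, smul_apply, tangentProj_smul,
      ContinuousLinearMap.smulRight_apply, tangentProj_smul, tangentProj_eq_self (hY.2 x hx)]
  torsion_free X Y hX hY x hx := by
    rw [euclideanConnection, euclideanConnection, ← tangentProj_sub]
    exact tangentProj_eq_self (lieBracket_mem_tangentAt hX hY hx)
  metric X Y Z hX hY hZ x hx := by
    have h1 := (hY.1.differentiable (by simp) x).hasFDerivAt
    have h2 := (hZ.1.differentiable (by simp) x).hasFDerivAt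
    have h := ((h1.fst.inner ℝ h2.fst).fun_add (h1.snd.inner ℝ h2.snd)).fderiv
    rw [gE_isSmoothForm.symm x (Y x), euclideanConnection, euclideanConnection,
      gE_tangentProj _ (hZ.2 x hx), gE_tangentProj _ (hY.2 x hx)]
    simp only [gE]
    rw [h]
    simp only [add_apply, ContinuousLinearMap.comp_apply,
      ContinuousLinearMap.prod_apply, fderivInnerCLM_apply, ContinuousLinearMap.coe_fst',
      ContinuousLinearMap.coe_snd']
    rw [real_inner_comm (Y x).1, real_inner_comm (Y x).2]
    ring

/-- A curve with normal acceleration is a Euclidean geodesic. The local extension of `γ'` is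
borrowed from the hypothesis that `γ` is a geodesic of some `g`. -/
theorem isGeodesic_gE_of_tangentProj_eq_zero {g : Amb → Amb → Amb → ℝ} {γ : ℝ → Amb}
    (hγ : IsGeodesic g γ) (Γ : ℝ → Amb) (hΓ : ∀ t, HasDerivAt (deriv γ) (Γ t) t)
    (h : ∀ t, tangentProj (γ t) (Γ t) = 0) : IsGeodesic gE γ := by
  obtain ⟨hs, hS, hreg, D, -, hX⟩ := hγ
  refine ⟨hs, hS, hreg, euclideanConnection, isLeviCivita_euclideanConnection, fun t => ?_⟩
  obtain ⟨X, hXvf, hXγ, -⟩ := hX t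
  refine ⟨X, hXvf, hXγ, ?_⟩
  have h1 := (hXvf.1.differentiable (by simp) (γ t)).hasFDerivAt.comp_hasDerivAt t
    (hs.differentiable (by simp) t).hasDerivAt
  have h2 := (h1.congr_of_eventuallyEq (f₁ := deriv γ)
    (by filter_upwards [hXγ] with s hs using hs.symm)).unique (hΓ t)
  rw [euclideanConnection, hXγ.self_of_nhds, h2, h t]

/-! ## Comparison with Euclidean geodesics and eigenvectors of `P` -/

/-- Both `⟨f, f c⟩` and `⟨f, c f⟩` equal `‖f‖² Re c`. -/
theorem inner_mul_comm_sub (f c : Quat) : inner ℝ f (f * c - c * f) = (0 : ℝ) := by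
  simp only [Quaternion.inner_def, Quaternion.re_mul, Quaternion.imI_mul, Quaternion.imJ_mul,
    Quaternion.imK_mul, Quaternion.re_star, Quaternion.imI_star, Quaternion.imJ_star,
    Quaternion.imK_star, Quaternion.re_sub, Quaternion.imI_sub, Quaternion.imJ_sub,
    Quaternion.imK_sub]
  ring

/-- The norm of `f` is constant. This serves as the uniqueness theorem for the skew linear equations
below. -/
theorem eq_zero_of_hasDerivAt_of_inner_eq_zero {f f' : ℝ → Quat} (h : ∀ t, HasDerivAt f (f' t) t)
    (hf : ∀ t, inner ℝ (f t) (f' t) = (0 : ℝ)) (h0 : f 0 = 0) (t : ℝ) : f t = 0 := by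
  have h1 : ∀ t, HasDerivAt (fun t => inner ℝ (f t) (f t)) (0 : ℝ) t := fun t =>
    ((h t).inner ℝ (h t)).congr_deriv (by rw [real_inner_comm (f t), hf, add_zero])
  have h2 := is_const_of_deriv_eq_zero (fun t => (h1 t).differentiableAt)
    (fun t => (h1 t).deriv) t 0
  rwa [h0, inner_zero_left, inner_self_eq_zero] at h2

theorem re_c₁ {γ : ℝ → Amb} (hs : ContDiff ℝ ∞ γ) (hS : ∀ t, γ t ∈ S3S3) : (c₁ γ).re = 0 := by
  simp [c₁, re_alpha hs hS, re_beta hs hS]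

theorem re_c₂ {γ : ℝ → Amb} (hs : ContDiff ℝ ∞ γ) (hS : ∀ t, γ t ∈ S3S3) : (c₂ γ).re = 0 := by
  simp [c₂, re_alpha hs hS, re_beta hs hS, re_c₁ hs hS]

theorem alpha_zero_eq (γ : ℝ → Amb) :
    alpha γ 0 = ((1 + d₁ γ) / 2) • c₁ γ + (1 / 2 : ℝ) • c₂ γ := by
  rw [c₂, c₁]
  module

theorem beta_zero_eq (γ : ℝ → Amb) :
    beta γ 0 = ((1 - d₁ γ) / 2) • c₁ γ - (1 / 2 : ℝ) • c₂ γ := by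
  rw [c₂, c₁]
  module

theorem inner_c₂_c₁ (γ : ℝ → Amb) : inner ℝ (c₂ γ) (c₁ γ) = (0 : ℝ) := by
  by_cases h : c₁ γ = 0
  · rw [h, inner_zero_right]
  · have hn : ‖c₁ γ‖ ≠ 0 := norm_ne_zero_iff.mpr h
    rw [c₂, inner_sub_left, real_inner_smul_left, real_inner_self_eq_norm_sq, d₁]
    field_simp
    ring

/-- Orthogonal imaginary quaternions anticommute; if they also commute, their product is zero, and
`ℍ` has no zero divisors. -/
theorem eq_zero_or_eq_zero_of_commute {u v : Quat} (hu : u.re = 0) (hv : v.re = 0)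
    (huv : inner ℝ u v = (0 : ℝ)) (hc : u * v = v * u) : v = 0 ∨ u = 0 := by
  have h : u * v = -(v * u) := by
    simp [Quaternion.inner_def, hu, hv] at huv
    ext <;> simp [hu, hv]
    · linear_combination (-2) * huv
    all_goals ring
  have h2 : v * u = 0 := by
    rw [hc] at h
    have h3 := eq_neg_iff_add_eq_zero.mp h
    rwa [← two_smul ℝ, smul_eq_zero_iff_right two_ne_zero] at h3
  exact mul_eq_zero.mp h2

section

variable {γ : ℝ → Amb}

theorem alpha_eq_of_c₁_or_c₂ (hγ : IsGeodesic gNK γ) (h : c₁ γ = 0 ∨ c₂ γ = 0) (t : ℝ) :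
    alpha γ t = alpha γ 0 := by
  rcases h with h | h
  · have h1 := fun t => hasDerivAt_alpha hγ t
    simp only [h, mul_zero, zero_mul, sub_zero, smul_zero] at h1
    exact is_const_of_deriv_eq_zero (fun t => (h1 t).differentiableAt) (fun t => (h1 t).deriv) t 0
  · rw [← sub_eq_zero]
    refine eq_zero_of_hasDerivAt_of_inner_eq_zero (f := fun t => alpha γ t - alpha γ 0)
      (fun t => (hasDerivAt_alpha hγ t).sub_const _) (fun t => ?_) (sub_self _) t
    -- When `c₂ = 0`, `α(0)` is a multiple of `c₁` and commutes with it, so `α - α(0)` obeys the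
    -- same equation as `α`.
    have h2 : alpha γ t * c₁ γ - c₁ γ * alpha γ t =
        (alpha γ t - alpha γ 0) * c₁ γ - c₁ γ * (alpha γ t - alpha γ 0) := by
      rw [alpha_zero_eq, h]
      simp only [smul_zero, add_zero, sub_mul, mul_sub, smul_mul_assoc, mul_smul_comm]
      abel
    rw [real_inner_smul_right, h2, inner_mul_comm_sub, mul_zero]

theorem c₁_or_c₂_of_alpha_eq (hγ : IsGeodesic gNK γ) (h : ∀ t, alpha γ t = alpha γ 0) :
    c₁ γ = 0 ∨ c₂ γ = 0 := by
  have h1 := hasDerivAt_alpha hγ 0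
  rw [show alpha γ = fun _ => alpha γ 0 from funext h] at h1
  have h2 := h1.unique (hasDerivAt_const _ _)
  have h3 : alpha γ 0 * c₁ γ - c₁ γ * alpha γ 0 = 0 := by
    simpa using h2
  refine eq_zero_or_eq_zero_of_commute (re_c₂ hγ.1 hγ.2.1) (re_c₁ hγ.1 hγ.2.1) (inner_c₂_c₁ γ) ?_
  rw [← sub_eq_zero]
  have h4 : c₂ γ = (2 : ℝ) • alpha γ 0 - (1 + d₁ γ) • c₁ γ := by
    rw [alpha_zero_eq]
    module
  have h5 : c₂ γ * c₁ γ - c₁ γ * c₂ γ =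
      (2 : ℝ) • (alpha γ 0 * c₁ γ - c₁ γ * alpha γ 0) := by
    rw [h4]
    simp only [sub_mul, mul_sub, smul_mul_assoc, mul_smul_comm, smul_sub]
    abel
  rw [h5, h3, smul_zero]

theorem mul_self_of_re_eq_zero {a : Quat} (ha : a.re = 0) : a * a = (-‖a‖ ^ 2 : ℝ) • (1 : Quat) := by
  rw [sq, ← Quaternion.normSq_eq_norm_mul_self, Quaternion.normSq_def']
  ext <;> simp [ha] <;> ring

theorem isGeodesic_gE_iff (hγ : IsGeodesic gNK γ) :
    IsGeodesic gE γ ↔ c₁ γ = 0 ∨ c₂ γ = 0 := by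
  constructor
  · intro hE
    apply c₁_or_c₂_of_alpha_eq hγ
    have h1 := hasDerivAt_of_conj_eq (fun t => (hγ.2.1 t).1)
      (hasDerivAt_fst_mul_alpha hγ.1 hγ.2.1) (momentum_fst_gE hE)
    simp only [sub_self] at h1
    exact fun t => is_const_of_deriv_eq_zero (fun t => (h1 t).differentiableAt)
      (fun t => (h1 t).deriv) t 0
  · intro h
    have ha := alpha_eq_of_c₁_or_c₂ hγ h
    have hb : ∀ t, beta γ t = beta γ 0 := fun t => by
      have h1 := alpha_add_beta hγ t
      rwa [ha t, ← alpha_add_beta hγ 0, add_right_inj] at h1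
    have hderiv : deriv γ = fun t => ((γ t).1 * alpha γ 0, (γ t).2 * beta γ 0) := by
      funext t
      rw [deriv_trivialized hγ.2.1, ha, hb]
    refine isGeodesic_gE_of_tangentProj_eq_zero hγ
      (fun t => ((γ t).1 * alpha γ 0 * alpha γ 0, (γ t).2 * beta γ 0 * beta γ 0)) (fun t => ?_)
      fun t => ?_
    · rw [hderiv]
      have h1 := hasDerivAt_fst_mul_alpha hγ.1 hγ.2.1 t
      have h2 := hasDerivAt_snd_mul_beta hγ.1 hγ.2.1 t
      rw [ha] at h1
      rw [hb] at h2
      exact (h1.mul_const _).prodMk (h2.mul_const _)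
    -- Imaginary `α`, `β` square to `-‖α‖²`, `-‖β‖²`, so the acceleration is a multiple of the
    -- position in each factor.
    · have hx := hγ.2.1 t
      simp only [tangentProj, mul_assoc, mul_self_of_re_eq_zero (re_alpha hγ.1 hγ.2.1 0),
        mul_self_of_re_eq_zero (re_beta hγ.1 hγ.2.1 0), mul_smul_comm, mul_one,
        real_inner_smul_left, real_inner_self_eq_norm_sq, hx.1, hx.2]
      simp

theorem P_deriv_eq_neg_iff (hγ : IsGeodesic gNK γ) :
    (∀ t, P (γ t) (deriv γ t) = -deriv γ t) ↔ c₁ γ = 0 := by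
  have key : ∀ t, P (γ t) (deriv γ t) = -deriv γ t ↔ c₁ γ = 0 := fun t => by
    have hx := hγ.2.1 t
    rw [deriv_trivialized hγ.2.1, P_trivialized hx, Prod.neg_mk, ← mul_neg, ← mul_neg,
      Prod.mk.injEq, mul_right_inj' (ne_zero_of_norm_eq_one hx.1),
      mul_right_inj' (ne_zero_of_norm_eq_one hx.2), ← alpha_add_beta hγ t, eq_neg_iff_add_eq_zero,
      eq_neg_iff_add_eq_zero, add_comm (beta γ t), and_self]
  exact ⟨fun h => (key 0).mp (h 0), fun h t => (key t).mpr h⟩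

theorem P_deriv_eq_self_iff (hγ : IsGeodesic gNK γ) :
    (∀ t, P (γ t) (deriv γ t) = deriv γ t) ↔ c₁ γ ≠ 0 ∧ c₂ γ = 0 ∧ d₁ γ = 0 := by
  have key : ∀ t, P (γ t) (deriv γ t) = deriv γ t ↔ alpha γ t = beta γ t := fun t => by
    have hx := hγ.2.1 t
    rw [deriv_trivialized hγ.2.1, P_trivialized hx,
      Prod.mk.injEq, mul_right_inj' (ne_zero_of_norm_eq_one hx.1),
      mul_right_inj' (ne_zero_of_norm_eq_one hx.2), eq_comm, and_self]
  simp only [key]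
  constructor
  · intro h
    have hd : d₁ γ = 0 := by rw [d₁, h 0, sub_self, inner_zero_left, zero_div]
    -- If `c₁ = 2 α(0)` vanished, so would `γ'(0)`, against regularity.
    refine ⟨fun hc => hγ.2.2.1 0 ?_, by rw [c₂, h 0, hd, zero_smul, sub_self, sub_self], hd⟩
    rw [c₁, h 0, ← two_smul ℝ, smul_eq_zero_iff_right two_ne_zero] at hc
    rw [deriv_trivialized hγ.2.1, h 0, hc, mul_zero, mul_zero, Prod.mk_zero_zero]
  · rintro ⟨-, h2, hd⟩ t
    have h0 : alpha γ 0 = beta γ 0 := by rw [alpha_zero_eq, beta_zero_eq, h2, hd]; simp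
    have ha := alpha_eq_of_c₁_or_c₂ hγ (.inr h2) t
    have h1 := alpha_add_beta hγ t
    rw [ha, ← alpha_add_beta hγ 0, add_right_inj] at h1
    rw [ha, h1, h0]

end

/-! ## Explicit solutions -/

/-- The quaternion with the given components. -/
def quat (a b c d : ℝ) : Quat := ⟨a, b, c, d⟩

@[simp] theorem re_quat (a b c d : ℝ) : (quat a b c d).re = a := rfl
@[simp] theorem imI_quat (a b c d : ℝ) : (quat a b c d).imI = b := rfl
@[simp] theorem imJ_quat (a b c d : ℝ) : (quat a b c d).imJ = c := rfl
@[simp] theorem imK_quat (a b c d : ℝ) : (quat a b c d).imK = d := rfl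

theorem circ_eq (a t : ℝ) : circ a t = quat (Real.cos (a * t)) (Real.sin (a * t)) 0 0 := rfl

theorem twoFreq_eq (A B φ t : ℝ) : twoFreq A B φ t = quat
    (1 / (1 + φ ^ 2) * Real.cos (A * t) + φ ^ 2 / (1 + φ ^ 2) * Real.cos (B * t))
    (1 / (1 + φ ^ 2) * Real.sin (A * t) + φ ^ 2 / (1 + φ ^ 2) * Real.sin (B * t))
    (φ / (1 + φ ^ 2) * Real.sin (A * t) - φ / (1 + φ ^ 2) * Real.sin (B * t))
    (-(-(φ / (1 + φ ^ 2)) * Real.cos (A * t) + φ / (1 + φ ^ 2) * Real.cos (B * t))) := rfl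

theorem hasDerivAt_quat {f₀ f₁ f₂ f₃ : ℝ → ℝ} {a₀ a₁ a₂ a₃ t : ℝ} (h₀ : HasDerivAt f₀ a₀ t)
    (h₁ : HasDerivAt f₁ a₁ t) (h₂ : HasDerivAt f₂ a₂ t) (h₃ : HasDerivAt f₃ a₃ t) :
    HasDerivAt (fun t => quat (f₀ t) (f₁ t) (f₂ t) (f₃ t)) (quat a₀ a₁ a₂ a₃) t := by
  have key : ∀ a b c d : ℝ, quat a b c d = a • quat 1 0 0 0 +
      b • quat 0 1 0 0 + c • quat 0 0 1 0 + d • quat 0 0 0 1 := by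
    intro a b c d
    ext <;>
      simp only [re_quat, imI_quat, imJ_quat, imK_quat, Quaternion.re_add, Quaternion.imI_add,
        Quaternion.imJ_add, Quaternion.imK_add, Quaternion.re_smul, Quaternion.imI_smul,
        Quaternion.imJ_smul, Quaternion.imK_smul, smul_eq_mul] <;> ring
  rw [show (fun t => quat (f₀ t) (f₁ t) (f₂ t) (f₃ t)) = _ from funext fun t => key _ _ _ _,
    key a₀]
  exact (((h₀.smul_const _).fun_add (h₁.smul_const _)).fun_add (h₂.smul_const _)).fun_add
    (h₃.smul_const _)

theorem hasDerivAt_cos_mul (a t : ℝ) :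
    HasDerivAt (fun t => Real.cos (a * t)) (-(a * Real.sin (a * t))) t := by
  have h := (Real.hasDerivAt_cos (a * t)).comp t ((hasDerivAt_id t).const_mul a)
  exact h.congr_deriv (by ring)

theorem hasDerivAt_sin_mul (a t : ℝ) :
    HasDerivAt (fun t => Real.sin (a * t)) (a * Real.cos (a * t)) t := by
  have h := (Real.hasDerivAt_sin (a * t)).comp t ((hasDerivAt_id t).const_mul a)
  exact h.congr_deriv (by ring)

/-- Everything lies in the commutative span of `1` and `i`, so only the sum of the left and right
coefficients matters. -/
theorem hasDerivAt_circ {p m a : ℝ} (h : p + m = a) (t : ℝ) :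
    HasDerivAt (circ a)
      (quat 0 p 0 0 * circ a t + circ a t * quat 0 m 0 0) t := by
  refine (hasDerivAt_quat (hasDerivAt_cos_mul a t) (hasDerivAt_sin_mul a t)
    (hasDerivAt_const t 0) (hasDerivAt_const t 0)).congr_deriv ?_
  ext <;> simp [circ_eq, ← h] <;> ring

/-- The hypotheses say that `(1, φ)` is an eigenvector of the symmetric matrix with rows `(p, b)`,
`(b, -p)` for the eigenvalue `k`; in particular `k² = p² + b²`. The solution `exp (t (p i + b j))
exp (t m i)` mixes frequencies `±k` and `m` into `m ± k`. -/
theorem hasDerivAt_twoFreq {p b m k φ : ℝ} (h₁ : φ * b = k - p) (h₂ : b = φ * (k + p)) (t : ℝ) :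
    HasDerivAt (twoFreq (m + k) (m - k) φ)
      (quat 0 p b 0 * twoFreq (m + k) (m - k) φ t +
        twoFreq (m + k) (m - k) φ t * quat 0 m 0 0) t := by
  have hc₁ := hasDerivAt_cos_mul (m + k) t
  have hc₂ := hasDerivAt_cos_mul (m - k) t
  have hs₁ := hasDerivAt_sin_mul (m + k) t
  have hs₂ := hasDerivAt_sin_mul (m - k) t
  refine (hasDerivAt_quat
    ((hc₁.const_mul (1 / (1 + φ ^ 2))).fun_add (hc₂.const_mul (φ ^ 2 / (1 + φ ^ 2))))
    ((hs₁.const_mul (1 / (1 + φ ^ 2))).fun_add (hs₂.const_mul (φ ^ 2 / (1 + φ ^ 2))))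
    ((hs₁.const_mul (φ / (1 + φ ^ 2))).fun_sub (hs₂.const_mul (φ / (1 + φ ^ 2))))
    ((hc₁.const_mul (-(φ / (1 + φ ^ 2)))).fun_add
      (hc₂.const_mul (φ / (1 + φ ^ 2)))).fun_neg).congr_deriv ?_
  have hφ : 1 + φ ^ 2 ≠ 0 := by positivity
  rw [twoFreq_eq]
  generalize Real.cos ((m + k) * t) = C, Real.sin ((m + k) * t) = S, Real.cos ((m - k) * t) = C', Real.sin ((m - k) * t) = S'
  ext <;> simp <;> field_simp
  · linear_combination S * h₁ - S' * φ * h₂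
  · linear_combination φ * C' * h₂ - C * h₁
  · linear_combination -C * h₂ - φ * C' * h₁
  · linear_combination S * h₂ + φ * S' * h₁

theorem eq_of_hasDerivAt_mul_add_mul {K L : Quat} (hK : K.re = 0) (hL : L.re = 0) {f g : ℝ → Quat}
    (hf : ∀ t, HasDerivAt f (K * f t + f t * L) t) (hg : ∀ t, HasDerivAt g (K * g t + g t * L) t)
    (h0 : f 0 = g 0) (t : ℝ) : f t = g t := by
  rw [← sub_eq_zero]
  refine eq_zero_of_hasDerivAt_of_inner_eq_zero (f := fun t => f t - g t)
    (fun t => (hf t).fun_sub (hg t)) (fun t => ?_) (sub_eq_zero.mpr h0) t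
  -- The difference satisfies the same equation, whose right-hand side is orthogonal to it because
  -- `K` and `L` are imaginary.
  rw [show K * f t + f t * L - (K * g t + g t * L) = K * (f t - g t) + (f t - g t) * L by
    noncomm_ring]
  simp only [Quaternion.inner_def, Quaternion.re_mul, Quaternion.imI_mul, Quaternion.imJ_mul,
    Quaternion.imK_mul, Quaternion.re_star, Quaternion.imI_star, Quaternion.imJ_star,
    Quaternion.imK_star, Quaternion.re_add, Quaternion.imI_add, Quaternion.imJ_add,
    Quaternion.imK_add, hK, hL]
  ring

/-- A factor curve of a nearly Kähler geodesic is determined by the solution `δ` of a linear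
equation with constant coefficients. -/
theorem eq_mul_mul_inv {x a δ : ℝ → Quat} {c h : Quat} (hx : ∀ t, ‖x t‖ = 1) (hh : ‖h‖ = 1)
    (hc : c.re = 0) (hxa : ∀ t, HasDerivAt x (x t * a t) t)
    (hM : ∀ t, x t * ((3 : ℝ) • a t - c) * star (x t) =
      x 0 * ((3 : ℝ) • a 0 - c) * star (x 0))
    {K L : Quat} (hK : star h * (a 0 - (1 / 3 : ℝ) • c) * h = K)
    (hL : star h * ((1 / 3 : ℝ) • c) * h = L)
    (hδ : ∀ t, HasDerivAt δ (K * δ t + δ t * L) t) (hδ0 : δ 0 = 1) (t : ℝ) :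
    x t = x 0 * h * δ t * h⁻¹ := by
  have hre : (a 0).re = 0 := re_eq_zero_of_hasDerivAt hx (hxa 0)
  have hhh := star_mul_self_of_norm_eq_one hh
  have hhh' := self_mul_star_of_norm_eq_one hh
  have hx0 := star_mul_self_of_norm_eq_one (hx 0)
  have hx0' := self_mul_star_of_norm_eq_one (hx 0)
  have hconj : ∀ {b : Quat}, b.re = 0 → (star h * b * h).re = 0 := fun {b} hb => by
    simpa using re_conj (x := star h) hb
  have key : ∀ t, star h * star (x 0) * x t * h = δ t := by
    refine eq_of_hasDerivAt_mul_add_mul (K := K) (L := L) ?_ ?_ (fun t => ?_) hδ ?_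
    · rw [← hK]; exact hconj (by simp [hre, hc])
    · rw [← hL]; exact hconj (by simp [hc])
    · refine (((hxa t).const_mul (star h * star (x 0))).mul_const h).congr_deriv ?_
      -- Split `a = (3a - c) / 3 + c / 3`; the conserved momentum turns the first summand into a
      -- constant left coefficient.
      have h1 : x t * a t = x 0 * (a 0 - (1 / 3 : ℝ) • c) * star (x 0) * x t +
          x t * ((1 / 3 : ℝ) • c) := by
        have h2 : x t * ((3 : ℝ) • a t - c) =
            x 0 * ((3 : ℝ) • a 0 - c) * star (x 0) * x t := by
          rw [← hM, mul_assoc _ (star (x t)), star_mul_self_of_norm_eq_one (hx t), mul_one]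
        have h3 : a t = (1 / 3 : ℝ) • ((3 : ℝ) • a t - c) + (1 / 3 : ℝ) • c := by module
        rw [h3, mul_add, mul_smul_comm, h2,
          show a 0 - (1 / 3 : ℝ) • c = (1 / 3 : ℝ) • ((3 : ℝ) • a 0 - c) by module]
        simp only [mul_smul_comm, smul_mul_assoc]
      rw [h1, ← hK, ← hL]
      simp only [mul_add, add_mul, mul_assoc]
      simp only [← mul_assoc h (star h), ← mul_assoc (star (x 0)) (x 0), hhh', hx0, one_mul]
    · rw [hδ0, mul_assoc _ _ (x 0), hx0, mul_one, hhh]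
  rw [← key, inv_eq_star hh]
  simp only [mul_assoc, hhh', mul_one]
  rw [← mul_assoc h, hhh', one_mul, ← mul_assoc, hx0', one_mul]

/-! ## Orthonormal frames -/

/-- `i`, as a quaternion. -/
def unitI : Quat := quat 0 1 0 0

/-- `j`, as a quaternion. -/
def unitJ : Quat := quat 0 0 1 0

theorem exists_unit_smul {z : Quat} (hz : z ≠ 0) : ∃ g : Quat, ‖g‖ = 1 ∧ ∃ r : ℝ, z = r • g :=
  ⟨‖z‖⁻¹ • z, by rw [norm_smul, norm_inv, norm_norm, inv_mul_cancel₀ (norm_ne_zero_iff.mpr hz)],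
    ‖z‖, by rw [smul_smul, mul_inv_cancel₀ (norm_ne_zero_iff.mpr hz), one_smul]⟩

theorem sq_norm_eq (u : Quat) : ‖u‖ ^ 2 = u.re ^ 2 + u.imI ^ 2 + u.imJ ^ 2 + u.imK ^ 2 := by
  rw [sq, ← Quaternion.normSq_eq_norm_mul_self, Quaternion.normSq_def']

theorem exists_conj_eq_unitI {u : Quat} (hu : u.re = 0) :
    ∃ h : Quat, ‖h‖ = 1 ∧ star h * u * h = ‖u‖ • unitI := by
  -- Without the norm condition the conjugation equation is linear in `z`, and a nonzero solution
  -- can be rescaled.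
  suffices ∃ z : Quat, z ≠ 0 ∧ u * z = z * (‖u‖ • unitI) by
    obtain ⟨z, hz, huz⟩ := this
    obtain ⟨h, hh, r, rfl⟩ := exists_unit_smul hz
    have hr : r ≠ 0 := by rintro rfl; simp at hz
    rw [mul_smul_comm, smul_mul_assoc] at huz
    refine ⟨h, hh, ?_⟩
    rw [mul_assoc, smul_right_injective _ hr huz, ← mul_assoc, star_mul_self_of_norm_eq_one hh,
      one_mul]
  have hn := sq_norm_eq u
  by_cases h : (‖u‖ + u.imI : ℝ) = 0
  · have hJ : u.imJ = 0 ∧ u.imK = 0 := by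
      have : u.imJ ^ 2 + u.imK ^ 2 = 0 := by
        rw [eq_neg_of_add_eq_zero_left h, hu] at hn
        linarith
      constructor <;> nlinarith [sq_nonneg u.imJ, sq_nonneg u.imK]
    -- Here `u = -‖u‖ i`, and `j` anticommutes with `i`.
    refine ⟨unitJ, fun h => by simpa [unitJ] using congrArg (fun q : Quat => q.imJ) h, ?_⟩
    ext <;> simp [unitI, unitJ, hu, hJ]
    linarith
  -- The witness is `‖u‖ - u i`; use `u² = -‖u‖²`.
  · refine ⟨quat (‖u‖ + u.imI) 0 (-u.imK) u.imJ, fun hz => h ?_, ?_⟩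
    · simpa using congrArg (fun q : Quat => q.re) hz
    · rw [hu] at hn
      ext <;> simp [unitI, hu]
      · ring
      · linear_combination -hn
      · ring
      · ring

theorem exists_conj_eq_unitJ {w : Quat} (hw : w.re = 0) (hwI : w.imI = 0) :
    ∃ g : Quat, ‖g‖ = 1 ∧ star g * unitI * g = unitI ∧ star g * w * g = ‖w‖ • unitJ := by
  suffices ∃ z : Quat, z ≠ 0 ∧ unitI * z = z * unitI ∧ w * z = z * (‖w‖ • unitJ) by
    obtain ⟨z, hz, hi, huz⟩ := this
    obtain ⟨h, hh, r, rfl⟩ := exists_unit_smul hz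
    have hr : r ≠ 0 := by rintro rfl; simp at hz
    rw [mul_smul_comm, smul_mul_assoc] at huz hi
    refine ⟨h, hh, ?_, ?_⟩
    · rw [mul_assoc, smul_right_injective _ hr hi, ← mul_assoc, star_mul_self_of_norm_eq_one hh,
        one_mul]
    · rw [mul_assoc, smul_right_injective _ hr huz, ← mul_assoc, star_mul_self_of_norm_eq_one hh,
        one_mul]
  have hn := sq_norm_eq w
  by_cases h : (‖w‖ + w.imJ : ℝ) = 0
  · have hK : w.imK = 0 := by
      rw [eq_neg_of_add_eq_zero_left h, hw, hwI] at hn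
      nlinarith
    refine ⟨unitI, fun h => by simpa [unitI] using congrArg (fun q : Quat => q.imI) h, rfl, ?_⟩
    ext <;> simp [unitI, unitJ, hw, hK, hwI]
    linarith
  -- The witness is `‖w‖ - w j`; it lies in the span of `1` and `i` because `w` has no `i`
  -- component, so it commutes with `i`.
  · refine ⟨quat (‖w‖ + w.imJ) w.imK 0 0, fun hz => h ?_, ?_, ?_⟩
    · simpa using congrArg (fun q : Quat => q.re) hz
    · ext <;> simp [unitI]
    · rw [hw, hwI] at hn
      ext <;> simp [unitJ, hw, hwI]
      · linear_combination -hn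
      · ring

theorem exists_frame {u v : Quat} (hu : u.re = 0) (hv : v.re = 0) (hu0 : u ≠ 0)
    (huv : inner ℝ v u = (0 : ℝ)) :
    ∃ h : Quat, ‖h‖ = 1 ∧ star h * u * h = ‖u‖ • unitI ∧ star h * v * h = ‖v‖ • unitJ := by
  obtain ⟨h, hh, hhu⟩ := exists_conj_eq_unitI hu
  have hh' : ‖star h‖ = 1 := by rw [Quaternion.norm_star, hh]
  have hre : (star h * v * h).re = 0 := by simpa using re_conj (x := star h) hv
  have hI : (star h * v * h).imI = 0 := by
    have h1 : inner ℝ (star h * v * h) (star h * u * h) = (0 : ℝ) := by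
      rw [inner_mul_right_of_norm_eq_one hh, inner_mul_left_of_norm_eq_one hh', huv]
    rw [hhu, real_inner_smul_right] at h1
    have h2 := (mul_eq_zero.mp h1).resolve_left (norm_ne_zero_iff.mpr hu0)
    generalize star h * v * h = w at h2 ⊢
    simpa [Quaternion.inner_def, unitI] using h2
  obtain ⟨g, hg, hgI, hgw⟩ := exists_conj_eq_unitJ hre hI
  refine ⟨h * g, by rw [norm_mul, hh, hg, one_mul], ?_, ?_⟩
  · rw [star_mul, show star g * star h * u * (h * g) = star g * (star h * u * h) * g by
      noncomm_ring, hhu, mul_smul_comm, smul_mul_assoc, hgI]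
  · rw [star_mul, show star g * star h * v * (h * g) = star g * (star h * v * h) * g by
      noncomm_ring, hgw, norm_mul, norm_mul, hh, hh', one_mul, mul_one]

/-! ## Parametrizations of nearly Kähler geodesics -/

section

variable {γ : ℝ → Amb}

theorem hasParam_of_hasDerivAt (hγ : IsGeodesic gNK γ) {h K₁ K₂ L : Quat} {δ₁ δ₂ : ℝ → Quat}
    (hh : ‖h‖ = 1) (hK₁ : star h * (alpha γ 0 - (1 / 3 : ℝ) • c₁ γ) * h = K₁)
    (hK₂ : star h * (beta γ 0 - (1 / 3 : ℝ) • c₁ γ) * h = K₂)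
    (hL : star h * ((1 / 3 : ℝ) • c₁ γ) * h = L)
    (h₁ : ∀ t, HasDerivAt δ₁ (K₁ * δ₁ t + δ₁ t * L) t)
    (h₂ : ∀ t, HasDerivAt δ₂ (K₂ * δ₂ t + δ₂ t * L) t) (h₁0 : δ₁ 0 = 1) (h₂0 : δ₂ 0 = 1) :
    HasParam γ (fun t => (δ₁ t, δ₂ t)) := by
  have e₁ : ∀ t, (3 : ℝ) • alpha γ t - c₁ γ = 2 * alpha γ t - beta γ t := fun t => by
    rw [← alpha_add_beta hγ t, two_mul]
    module
  have e₂ : ∀ t, (3 : ℝ) • beta γ t - c₁ γ = 2 * beta γ t - alpha γ t := fun t => by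
    rw [← alpha_add_beta hγ t, two_mul]
    module
  refine ⟨(γ 0).1 * h, (γ 0).2 * h, h, by rw [norm_mul, hh, (hγ.2.1 0).1, one_mul],
    by rw [norm_mul, hh, (hγ.2.1 0).2, one_mul], hh, fun t => Prod.ext ?_ ?_⟩
  · exact eq_mul_mul_inv (fun t => (hγ.2.1 t).1) hh (re_c₁ hγ.1 hγ.2.1)
      (hasDerivAt_fst_mul_alpha hγ.1 hγ.2.1)
      (fun t => by rw [e₁, e₁]; exact momentum_fst hγ t) hK₁ hL h₁ h₁0 t
  · exact eq_mul_mul_inv (fun t => (hγ.2.1 t).2) hh (re_c₁ hγ.1 hγ.2.1)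
      (hasDerivAt_snd_mul_beta hγ.1 hγ.2.1)
      (fun t => by rw [e₂, e₂]; exact momentum_snd hγ t) hK₂ hL h₂ h₂0 t

theorem circ_zero (a : ℝ) : circ a 0 = 1 := by
  ext <;> simp [circ_eq]

theorem twoFreq_zero (A B φ : ℝ) : twoFreq A B φ 0 = 1 := by
  have hφ : 1 + φ ^ 2 ≠ 0 := by positivity
  rw [twoFreq_eq]
  ext <;> simp
  field_simp

theorem exists_hasParam_curve1 (hγ : IsGeodesic gNK γ) (hc : c₁ γ = 0) :
    ∃ a : ℝ, a ≠ 0 ∧ HasParam γ (curve1 a) := by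
  obtain ⟨h, hh, hu⟩ := exists_conj_eq_unitI (re_alpha hγ.1 hγ.2.1 0)
  have hb : beta γ 0 = -alpha γ 0 := by
    rw [← alpha_add_beta hγ 0, add_comm] at hc
    exact eq_neg_of_add_eq_zero_left hc
  refine ⟨‖alpha γ 0‖, fun h0 => hγ.2.2.1 0 ?_, ?_⟩
  · rw [norm_eq_zero] at h0
    rw [deriv_trivialized hγ.2.1, hb, h0, neg_zero, mul_zero, mul_zero, Prod.mk_zero_zero]
  · have h1 : curve1 ‖alpha γ 0‖ = fun t => (circ ‖alpha γ 0‖ t, circ (-‖alpha γ 0‖) t) := by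
      funext t
      simp [curve1, circ]
    rw [h1]
    refine hasParam_of_hasDerivAt hγ hh (K₁ := quat 0 ‖alpha γ 0‖ 0 0)
      (K₂ := quat 0 (-‖alpha γ 0‖) 0 0) (L := quat 0 0 0 0) ?_ ?_ ?_
      (hasDerivAt_circ (add_zero _)) (hasDerivAt_circ (add_zero _)) (circ_zero _) (circ_zero _)
    · rw [hc, smul_zero, sub_zero, hu]
      ext <;> simp [unitI]
    · rw [hc, smul_zero, sub_zero, hb, mul_neg, neg_mul, hu]
      ext <;> simp [unitI]
    · rw [hc, smul_zero, mul_zero, zero_mul]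
      rfl

/-- In the frame of `c₁` and `c₂`, the coefficients of the linear equation of a geodesic. -/
theorem exists_frame_coeff (hγ : IsGeodesic gNK γ) (hc : c₁ γ ≠ 0) :
    ∃ h : Quat, ‖h‖ = 1 ∧
      star h * (alpha γ 0 - (1 / 3 : ℝ) • c₁ γ) * h =
        quat 0 (cA ‖c₁ γ‖ (d₁ γ) - 2 / 3 * ‖c₁ γ‖ / 2) (‖c₂ γ‖ / 2) 0 ∧
      star h * (beta γ 0 - (1 / 3 : ℝ) • c₁ γ) * h =
        quat 0 (cA' ‖c₁ γ‖ (d₁ γ) - 2 / 3 * ‖c₁ γ‖ / 2) (-(‖c₂ γ‖ / 2)) 0 ∧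
      star h * ((1 / 3 : ℝ) • c₁ γ) * h = quat 0 (2 / 3 * ‖c₁ γ‖ / 2) 0 0 := by
  obtain ⟨h, hh, h1, h2⟩ := exists_frame (re_c₁ hγ.1 hγ.2.1) (re_c₂ hγ.1 hγ.2.1) hc
    (inner_c₂_c₁ γ)
  refine ⟨h, hh, ?_, ?_, ?_⟩
  · rw [alpha_zero_eq]
    simp only [mul_sub, sub_mul, mul_add, add_mul, mul_smul_comm, smul_mul_assoc, h1, h2]
    ext <;> simp [unitI, unitJ, cA] <;> ring
  · rw [beta_zero_eq]
    simp only [mul_sub, sub_mul, mul_smul_comm, smul_mul_assoc, h1, h2]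
    ext <;> simp [unitI, unitJ, cA'] <;> ring
  · rw [mul_smul_comm, smul_mul_assoc, h1]
    ext <;> simp [unitI]
    ring

theorem hasParam_curve2 (hγ : IsGeodesic gNK γ) (hc : c₁ γ ≠ 0) (hc₂ : c₂ γ = 0) :
    HasParam γ (curve2 ‖c₁ γ‖ (d₁ γ)) := by
  obtain ⟨h, hh, h1, h2, h3⟩ := exists_frame_coeff hγ hc
  rw [hc₂, norm_zero, zero_div] at h1 h2
  rw [neg_zero] at h2
  exact hasParam_of_hasDerivAt hγ hh h1 h2 h3
    (hasDerivAt_circ (by ring)) (hasDerivAt_circ (by ring)) (circ_zero _) (circ_zero _)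

/-- These are the eigenvector equations of `hasDerivAt_twoFreq` with `p = a - c/2` and `k` half the
square root. -/
theorem phi_relations {a b c : ℝ} (hb : b ≠ 0) :
    phi a b c * b = √((2 * a - c) ^ 2 + 4 * b ^ 2) / 2 - (a - c / 2) ∧
      b = phi a b c * (√((2 * a - c) ^ 2 + 4 * b ^ 2) / 2 + (a - c / 2)) := by
  have hs : √((2 * a - c) ^ 2 + 4 * b ^ 2) ^ 2 = (2 * a - c) ^ 2 + 4 * b ^ 2 :=
    Real.sq_sqrt (by positivity)
  have h : (c - 2 * a) ^ 2 = (2 * a - c) ^ 2 := by ring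
  rw [phi, h]
  set s := √((2 * a - c) ^ 2 + 4 * b ^ 2)
  constructor
  · field_simp
    ring
  · field_simp
    linear_combination -hs

theorem hasDerivAt_twoFreq_freq {a b c : ℝ} (hb : b ≠ 0) (t : ℝ) :
    HasDerivAt (twoFreq (freqA a b c) (freqB a b c) (phi a b c))
      (quat 0 (a - c / 2) b 0 * twoFreq (freqA a b c) (freqB a b c) (phi a b c) t +
        twoFreq (freqA a b c) (freqB a b c) (phi a b c) t * quat 0 (c / 2) 0 0) t := by
  have h := phi_relations (a := a) (c := c) hb
  rw [freqA, freqB, add_div, sub_div]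
  exact hasDerivAt_twoFreq h.1 h.2 t

theorem hasParam_curve3 (hγ : IsGeodesic gNK γ) (hc : c₁ γ ≠ 0) (hc₂ : c₂ γ ≠ 0) :
    HasParam γ (curve3 ‖c₁ γ‖ ‖c₂ γ‖ (d₁ γ)) := by
  obtain ⟨h, hh, h1, h2, h3⟩ := exists_frame_coeff hγ hc
  have hb : ‖c₂ γ‖ / 2 ≠ 0 := div_ne_zero (norm_ne_zero_iff.mpr hc₂) two_ne_zero
  exact hasParam_of_hasDerivAt hγ hh h1 h2 h3 (hasDerivAt_twoFreq_freq hb)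
    (hasDerivAt_twoFreq_freq (neg_ne_zero.mpr hb)) (twoFreq_zero _ _ _) (twoFreq_zero _ _ _)

end

/-! ## Closed curves -/

theorem HasParam.isClosedCurve_iff {γ δ : ℝ → Amb} (h : HasParam γ δ) :
    IsClosedCurve γ ↔ IsClosedCurve δ := by
  obtain ⟨u, v, h, hu, hv, hh, hγ⟩ := h
  refine exists_congr fun T => and_congr_right fun _ => forall_congr' fun t => ?_
  rw [hγ, hγ, Prod.mk.injEq, Prod.ext_iff,
    mul_left_inj' (inv_ne_zero (ne_zero_of_norm_eq_one hh)),
    mul_left_inj' (inv_ne_zero (ne_zero_of_norm_eq_one hh)),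
    mul_right_inj' (ne_zero_of_norm_eq_one hu), mul_right_inj' (ne_zero_of_norm_eq_one hv)]

theorem isClosedCurve_of_ne_zero {δ : ℝ → Amb} {T : ℝ} (hT : T ≠ 0) (h : ∀ t, δ (t + T) = δ t) :
    IsClosedCurve δ := by
  rcases hT.lt_or_gt with hT | hT
  · exact ⟨-T, neg_pos.mpr hT, fun t => by rw [← h (t + -T), neg_add_cancel_right]⟩
  · exact ⟨T, hT, h⟩

theorem cos_mul_add_period {a T : ℝ} (h : ∃ n : ℤ, (n : ℝ) * (2 * Real.pi) = a * T) (t : ℝ) :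
    Real.cos (a * (t + T)) = Real.cos (a * t) := by
  obtain ⟨n, hn⟩ := h
  rw [mul_add, ← hn, Real.cos_add_int_mul_two_pi]

theorem sin_mul_add_period {a T : ℝ} (h : ∃ n : ℤ, (n : ℝ) * (2 * Real.pi) = a * T) (t : ℝ) :
    Real.sin (a * (t + T)) = Real.sin (a * t) := by
  obtain ⟨n, hn⟩ := h
  rw [mul_add, ← hn, Real.sin_add_int_mul_two_pi]

theorem isClosedCurve_curve1 {a : ℝ} (ha : a ≠ 0) : IsClosedCurve (curve1 a) := by
  have h : ∃ n : ℤ, (n : ℝ) * (2 * Real.pi) = a * (2 * Real.pi / a) :=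
    ⟨1, by field_simp; simp⟩
  refine isClosedCurve_of_ne_zero (T := 2 * Real.pi / a)
    (div_ne_zero Real.two_pi_pos.ne' ha) fun t => ?_
  simp only [curve1, cos_mul_add_period h, sin_mul_add_period h]

theorem rationalRatio_of_period {r s T : ℝ} (hT : T ≠ 0)
    (hr : ∃ n : ℤ, (n : ℝ) * (2 * Real.pi) = r * T)
    (hs : ∃ n : ℤ, (n : ℝ) * (2 * Real.pi) = s * T) : RationalRatio r s := by
  by_cases h0 : s = 0
  · exact .inl h0
  · obtain ⟨m, hm⟩ := hr
    obtain ⟨n, hn⟩ := hs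
    refine .inr ⟨m / n, ?_⟩
    have hn0 : (n : ℝ) ≠ 0 := by
      intro h
      rw [h, zero_mul, eq_comm, mul_eq_zero] at hn
      exact hn.elim h0 hT
    push_cast
    rw [div_eq_div_iff h0 hn0]
    have hpi := Real.two_pi_pos.ne'
    apply mul_right_cancel₀ (mul_ne_zero hT hpi)
    linear_combination (r * T) * hn - (s * T) * hm

/-- The form `k · 2π / (r + s)` of the period allows two factors with the same frequency sum to be
synchronized. For `r / s = m / n` the period is `2π n / s`, and `k = m + n` is nonzero since `r + s`
is. -/
theorem exists_period_of_rationalRatio {r s : ℝ} (h : RationalRatio r s) (h0 : r + s ≠ 0) :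
    ∃ T : ℝ, T ≠ 0 ∧ (∃ k : ℤ, k ≠ 0 ∧ T = k * (2 * Real.pi / (r + s))) ∧
      (∃ n : ℤ, (n : ℝ) * (2 * Real.pi) = r * T) ∧
      ∃ n : ℤ, (n : ℝ) * (2 * Real.pi) = s * T := by
  have hpi := Real.two_pi_pos.ne'
  by_cases hs : s = 0
  · subst hs
    rw [add_zero] at h0
    refine ⟨2 * Real.pi / r, div_ne_zero hpi h0, ⟨1, one_ne_zero, by simp⟩, ⟨1, ?_⟩, ⟨0, by simp⟩⟩
    field_simp
    simp
  · obtain ⟨q, hq⟩ := h.resolve_left hs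
    have hr : r = q * s := by rw [← hq, div_mul_cancel₀ _ hs]
    have hk : r + s = (q.num + q.den : ℤ) / (q.den : ℝ) * s := by
      rw [hr]
      nth_rewrite 1 [← Rat.num_div_den q]
      have := q.den_ne_zero
      push_cast
      field_simp
    have hden : (q.den : ℝ) ≠ 0 := by exact_mod_cast q.den_ne_zero
    have hk0 : ((q.num + q.den : ℤ) : ℝ) ≠ 0 := by
      intro h
      rw [h, zero_div, zero_mul] at hk
      exact h0 hk
    refine ⟨(q.den : ℝ) * (2 * Real.pi) / s, div_ne_zero (mul_ne_zero hden hpi) hs,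
      ⟨q.num + q.den, by exact_mod_cast hk0, ?_⟩, ⟨q.num, ?_⟩, ⟨q.den, ?_⟩⟩
    · rw [hk]
      field_simp
    · rw [hr]
      nth_rewrite 2 [← Rat.num_div_den q]
      push_cast
      field_simp
    · push_cast
      field_simp

theorem exists_int_mul_period {a T : ℝ} (h : ∃ n : ℤ, (n : ℝ) * (2 * Real.pi) = a * T) (k : ℤ) :
    ∃ n : ℤ, (n : ℝ) * (2 * Real.pi) = a * (k * T) := by
  obtain ⟨n, hn⟩ := h
  exact ⟨k * n, by push_cast; linear_combination (k : ℝ) * hn⟩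

theorem circ_eq_one {a T : ℝ} (h : circ a T = 1) :
    ∃ n : ℤ, (n : ℝ) * (2 * Real.pi) = a * T := by
  have h1 := congrArg (fun q : Quat => q.re) h
  simp only [circ_eq, re_quat, Quaternion.re_one] at h1
  exact (Real.cos_eq_one_iff _).mp h1

/-- The real part is a convex combination of two cosines with positive weights, so it reaches `1`
only when both cosines do. -/
theorem twoFreq_eq_one {A B φ T : ℝ} (hφ : φ ≠ 0) (h : twoFreq A B φ T = 1) :
    (∃ n : ℤ, (n : ℝ) * (2 * Real.pi) = A * T) ∧ ∃ n : ℤ, (n : ℝ) * (2 * Real.pi) = B * T := by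
  have h1 := congrArg (fun q : Quat => q.re) h
  have h2 : 0 < 1 + φ ^ 2 := by positivity
  have h3 : 0 < φ ^ 2 := by positivity
  simp only [twoFreq_eq, re_quat, Quaternion.re_one] at h1
  have hA := Real.cos_le_one (A * T)
  have hB := Real.cos_le_one (B * T)
  rw [← Real.cos_eq_one_iff, ← Real.cos_eq_one_iff]
  generalize Real.cos (A * T) = x, Real.cos (B * T) = y at *
  field_simp at h1
  constructor <;> nlinarith

theorem isClosedCurve_curve2_iff {n₁ d : ℝ} (hn : 0 < n₁) :
    IsClosedCurve (curve2 n₁ d) ↔ RationalRatio (cA n₁ d) (cA' n₁ d) := by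
  constructor
  · rintro ⟨T, hT, h⟩
    have h0 := h 0
    simp only [curve2, zero_add, circ_zero, Prod.mk.injEq] at h0
    exact rationalRatio_of_period hT.ne' (circ_eq_one h0.1) (circ_eq_one h0.2)
  · intro h
    have hsum : cA n₁ d + cA' n₁ d = n₁ := by rw [cA, cA']; ring
    obtain ⟨T, hT, -, h1, h2⟩ := exists_period_of_rationalRatio h (by rw [hsum]; exact hn.ne')
    refine isClosedCurve_of_ne_zero hT fun t => ?_
    simp only [curve2, circ_eq, cos_mul_add_period h1, sin_mul_add_period h1,
      cos_mul_add_period h2, sin_mul_add_period h2]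

theorem phi_ne_zero {a b c : ℝ} (hb : b ≠ 0) : phi a b c ≠ 0 := by
  intro h
  have h1 := (phi_relations (a := a) (c := c) hb).2
  rw [h, zero_mul] at h1
  exact hb h1

theorem freqB_add_freqA (a b c : ℝ) : freqB a b c + freqA a b c = c := by
  rw [freqA, freqB]
  ring

theorem isClosedCurve_curve3_iff {n₁ n₂ d : ℝ} (hn₁ : 0 < n₁) (hn₂ : 0 < n₂) :
    IsClosedCurve (curve3 n₁ n₂ d) ↔ RationalRatio (fB n₁ n₂ d) (fA n₁ n₂ d) ∧
      RationalRatio (fB' n₁ n₂ d) (fA' n₁ n₂ d) := by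
  have hb : n₂ / 2 ≠ 0 := by positivity
  constructor
  · rintro ⟨T, hT, h⟩
    have h0 := h 0
    simp only [curve3, zero_add, twoFreq_zero, Prod.mk.injEq] at h0
    have h1 := twoFreq_eq_one (phi_ne_zero hb) h0.1
    have h2 := twoFreq_eq_one (phi_ne_zero (neg_ne_zero.mpr hb)) h0.2
    exact ⟨rationalRatio_of_period hT.ne' h1.2 h1.1, rationalRatio_of_period hT.ne' h2.2 h2.1⟩
  · rintro ⟨h, h'⟩
    have hsum : fB n₁ n₂ d + fA n₁ n₂ d = 2 / 3 * n₁ := freqB_add_freqA _ _ _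
    have hsum' : fB' n₁ n₂ d + fA' n₁ n₂ d = 2 / 3 * n₁ := freqB_add_freqA _ _ _
    have hc : 2 / 3 * n₁ ≠ 0 := by positivity
    obtain ⟨T, hT, ⟨k, hk, hTk⟩, hB, hA⟩ := exists_period_of_rationalRatio h (by rwa [hsum])
    obtain ⟨T', hT', ⟨k', hk', hTk'⟩, hB', hA'⟩ :=
      exists_period_of_rationalRatio h' (by rwa [hsum'])
    -- Both frequency sums are `c`, so both sides equal `k k' · 2π / c`.
    have hTT : (k' : ℝ) * T = k * T' := by
      rw [hTk, hTk', hsum, hsum']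
      ring
    refine isClosedCurve_of_ne_zero (T := k' * T)
      (mul_ne_zero (by exact_mod_cast hk') hT) fun t => ?_
    have pA := exists_int_mul_period hA k'
    have pB := exists_int_mul_period hB k'
    have pA' := exists_int_mul_period hA' k
    have pB' := exists_int_mul_period hB' k
    rw [← hTT] at pA' pB'
    simp only [curve3, twoFreq_eq, cos_mul_add_period pA, sin_mul_add_period pA,
      cos_mul_add_period pB, sin_mul_add_period pB, cos_mul_add_period pA',
      sin_mul_add_period pA', cos_mul_add_period pB', sin_mul_add_period pB']

theorem isClosedCurve_iff_constants {γ : ℝ → Amb} (hγ : IsGeodesic gNK γ) :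
    IsClosedCurve γ ↔ c₁ γ = 0 ∨
      (c₁ γ ≠ 0 ∧ c₂ γ = 0 ∧ RationalRatio (cA ‖c₁ γ‖ (d₁ γ)) (cA' ‖c₁ γ‖ (d₁ γ))) ∨
      (c₁ γ ≠ 0 ∧ c₂ γ ≠ 0 ∧
        RationalRatio (fB ‖c₁ γ‖ ‖c₂ γ‖ (d₁ γ)) (fA ‖c₁ γ‖ ‖c₂ γ‖ (d₁ γ)) ∧
        RationalRatio (fB' ‖c₁ γ‖ ‖c₂ γ‖ (d₁ γ)) (fA' ‖c₁ γ‖ ‖c₂ γ‖ (d₁ γ))) := by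
  by_cases h1 : c₁ γ = 0
  · obtain ⟨a, ha, hp⟩ := exists_hasParam_curve1 hγ h1
    simp only [h1, true_or, iff_true]
    exact hp.isClosedCurve_iff.mpr (isClosedCurve_curve1 ha)
  · by_cases h2 : c₂ γ = 0
    · rw [(hasParam_curve2 hγ h1 h2).isClosedCurve_iff,
        isClosedCurve_curve2_iff (norm_pos_iff.mpr h1)]
      refine ⟨fun h => .inr (.inl ⟨h1, h2, h⟩), ?_⟩
      rintro (h | ⟨-, -, h⟩ | ⟨-, h, -⟩)
      exacts [absurd h h1, h, absurd h2 h]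
    · rw [(hasParam_curve3 hγ h1 h2).isClosedCurve_iff,
        isClosedCurve_curve3_iff (norm_pos_iff.mpr h1) (norm_pos_iff.mpr h2)]
      refine ⟨fun h => .inr (.inr ⟨h1, h2, h⟩), ?_⟩
      rintro (h | ⟨-, h, -⟩ | ⟨-, -, h⟩)
      exacts [absurd h h1, absurd h h2, h]

theorem isClosedCurve_iff_hasParam {γ : ℝ → Amb} (hγ : IsGeodesic gNK γ) :
    IsClosedCurve γ ↔ (∃ a : ℝ, a ≠ 0 ∧ HasParam γ (curve1 a)) ∨
      (∃ n₁ d : ℝ, 0 < n₁ ∧ HasParam γ (curve2 n₁ d) ∧ RationalRatio (cA n₁ d) (cA' n₁ d)) ∨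
      (∃ n₁ n₂ d : ℝ, 0 < n₁ ∧ 0 < n₂ ∧ HasParam γ (curve3 n₁ n₂ d) ∧
        RationalRatio (fB n₁ n₂ d) (fA n₁ n₂ d) ∧ RationalRatio (fB' n₁ n₂ d) (fA' n₁ n₂ d)) := by
  constructor
  · intro h
    rcases (isClosedCurve_iff_constants hγ).mp h with h1 | ⟨h1, h2, hr⟩ | ⟨h1, h2, hr⟩
    · exact .inl (exists_hasParam_curve1 hγ h1)
    · exact .inr (.inl ⟨_, _, norm_pos_iff.mpr h1, hasParam_curve2 hγ h1 h2, hr⟩)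
    · exact .inr (.inr ⟨_, _, _, norm_pos_iff.mpr h1, norm_pos_iff.mpr h2,
        hasParam_curve3 hγ h1 h2, hr⟩)
  -- Each model curve is closed by itself, so its parameters need not be matched with the constants
  -- of `γ`.
  · rintro (⟨a, ha, hp⟩ | ⟨n₁, d, hn, hp, hr⟩ | ⟨n₁, n₂, d, hn₁, hn₂, hp, hr⟩)
    · exact hp.isClosedCurve_iff.mpr (isClosedCurve_curve1 ha)
    · exact hp.isClosedCurve_iff.mpr ((isClosedCurve_curve2_iff hn).mpr hr)
    · exact hp.isClosedCurve_iff.mpr ((isClosedCurve_curve3_iff hn₁ hn₂).mpr hr)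

end NKS3S3

end

theorem proposition3p1 (γ : ℝ → NKS3S3.Amb) (hγ : NKS3S3.IsGeodesic NKS3S3.gNK γ) :
    -- comparison with Euclidean geodesics
    (NKS3S3.IsGeodesic NKS3S3.gE γ ↔ NKS3S3.c₁ γ = 0 ∨ NKS3S3.c₂ γ = 0) ∧
    -- eigenvectors of `P`
    ((∀ t, NKS3S3.P (γ t) (deriv γ t) = -deriv γ t) ↔ NKS3S3.c₁ γ = 0) ∧
    ((∀ t, NKS3S3.P (γ t) (deriv γ t) = deriv γ t) ↔
      NKS3S3.c₁ γ ≠ 0 ∧ NKS3S3.c₂ γ = 0 ∧ NKS3S3.d₁ γ = 0) ∧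
    -- closed geodesics, through the explicit parametrizations
    (NKS3S3.IsClosedCurve γ ↔
      (∃ a : ℝ, a ≠ 0 ∧ NKS3S3.HasParam γ (NKS3S3.curve1 a)) ∨
      (∃ n₁ d : ℝ, 0 < n₁ ∧ NKS3S3.HasParam γ (NKS3S3.curve2 n₁ d) ∧
        NKS3S3.RationalRatio (NKS3S3.cA n₁ d) (NKS3S3.cA' n₁ d)) ∨
      (∃ n₁ n₂ d : ℝ, 0 < n₁ ∧ 0 < n₂ ∧ NKS3S3.HasParam γ (NKS3S3.curve3 n₁ n₂ d) ∧
        NKS3S3.RationalRatio (NKS3S3.fB n₁ n₂ d) (NKS3S3.fA n₁ n₂ d) ∧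
        NKS3S3.RationalRatio (NKS3S3.fB' n₁ n₂ d) (NKS3S3.fA' n₁ n₂ d))) ∧
    -- closed geodesics, through the constants of `γ`
    (NKS3S3.IsClosedCurve γ ↔
      NKS3S3.c₁ γ = 0 ∨
      (NKS3S3.c₁ γ ≠ 0 ∧ NKS3S3.c₂ γ = 0 ∧
        NKS3S3.RationalRatio (NKS3S3.cA ‖NKS3S3.c₁ γ‖ (NKS3S3.d₁ γ))
          (NKS3S3.cA' ‖NKS3S3.c₁ γ‖ (NKS3S3.d₁ γ))) ∨
      (NKS3S3.c₁ γ ≠ 0 ∧ NKS3S3.c₂ γ ≠ 0 ∧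
        NKS3S3.RationalRatio (NKS3S3.fB ‖NKS3S3.c₁ γ‖ ‖NKS3S3.c₂ γ‖ (NKS3S3.d₁ γ))
          (NKS3S3.fA ‖NKS3S3.c₁ γ‖ ‖NKS3S3.c₂ γ‖ (NKS3S3.d₁ γ)) ∧
        NKS3S3.RationalRatio (NKS3S3.fB' ‖NKS3S3.c₁ γ‖ ‖NKS3S3.c₂ γ‖ (NKS3S3.d₁ γ))
          (NKS3S3.fA' ‖NKS3S3.c₁ γ‖ ‖NKS3S3.c₂ γ‖ (NKS3S3.d₁ γ)))) := by
  exact ⟨NKS3S3.isGeodesic_gE_iff hγ, NKS3S3.P_deriv_eq_neg_iff hγ, NKS3S3.P_deriv_eq_self_iff hγ,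
    NKS3S3.isClosedCurve_iff_hasParam hγ, NKS3S3.isClosedCurve_iff_constants hγ⟩
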